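/- Consider an $s$-stage Runge–Kutta method ($s\ge 1$) with real coefficient matrix $\mathbf A\in\mathbb R^{s\times s}$ and weights $\mathbf b\in\mathbb R^s$. Put $\mathbb 1=(1,\dots,1)^T$ and $$\mathbf q(z)=\mathbf b^T(\mathbf I-z\mathbf A)^{-1},\qquad r(z)=1+z\,\mathbf b^T(\mathbf I-z\mathbf A)^{-1}\mathbb 1 .$$ Assume that the method - has classical order at least one, i.e. $\sum_i b_i=1$; - is A-stable: $\mathbf I-z\mathbf A$ is nonsingular and $|r(z)|\le 1$ for all $\Re z\le 0$; - satisfies $|r(\mathrm i y)|<1$ for all real $y\neq 0$; - has an invertible matrix $\mathbf A$; - is stiffly accurate: $\mathbf b^T\mathbf A^{-1}=(0,\dots,0,1)$. Let $h>0$, $x\in\mathbb R$, $d=|x|$. For $z\in\mathbb C\setminus(-\infty,0]$ and $\lambda>0$ let $$K(z,x)=\frac{1}{2\sqrt{z/\mathrm i}}\,e^{-d\sqrt{z/\mathrm i}},\qquad \sqrt{z/\mathrm i}:=e^{-\mathrm i\pi/4}\sqrt z \ \text{(principal branch)},\qquad G(\lambda,x)=\frac{\mathrm i e^{\mathrm i\pi/4}}{\sqrt\lambda}\cosh\!\big(d\,e^{\mathrm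 i\pi/4}\sqrt\lambda\big);$$ $G(\lambda,x)=K(\lambda e^{-\mathrm i\pi},x)-K(\lambda e^{\mathrm i\pi},x)$ is the jump of $K$ across the negative real axis. With $\boldsymbol\Delta(\zeta)=\big(\mathbf A+\frac{\zeta}{1-\zeta}\mathbb 1\mathbf b^T\big)^{-1}$, define $\mathbf W_n$ and $\mathbf E_n(z)$ by the expansions at $\zeta=0$ $$\sum_{n\ge0}\mathbf W_n\zeta^n=K\!\Big(\frac{\boldsymbol\Delta(\zeta)}{h},x\Big)\ \text{(matrix function)},\qquad \sum_{n\ge0}\mathbf E_n(z)\zeta^n=(\boldsymbol\Delta(\zeta)-z\mathbf I)^{-1},$$ let $\boldsymbol\omega_n(x)$ and $\mathbf e_n(z)$ be the last rows of $\mathbf W_n$ and $\mathbf E_n(z)$, and for $\xi>0$ let $$\mathbf I_n=\frac{h}{2\pi\mathrm i}\int_0^{\xi}G(\lambda,x)\,\mathbf e_n(-h\lambda)\,d\lambda,\qquad \gamma(\xi)=\inf_{-\xi\le\Re z<0,\ r(z)\ne0}\frac{\log|r(z)|}{\Re z}.$$ Fix any norm (or seminorm) $\|\cdot\|$ on row vectors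 in $\mathbb C^s$, and let $\xi>1$. Then $\gamma(h\xi)>0$, and there is a constant $C_A>0$ with $$\max\big(|r(z)|,\|\mathbf q(z)\|\big)\le C_A|z|^{-1}\qquad\text{for all } z\ne0,\ \Re z\le 0. \tag{$*$}$$ For every constant $C_A>0$ satisfying $(*)$, every $\varepsilon>0$ and every integer $n\ge0$, $$\|\boldsymbol\omega_n(x)-\mathbf I_n\|\le\varepsilon\quad\text{if}\quad n\ge\frac{1}{h\xi\gamma(h\xi)}\left(d\sqrt{\xi/2}+\log\frac{C_A\sqrt{2\pi}}{4\sqrt{\xi}\,\Gamma(3/4)^2\,\varepsilon}\right).$$ -/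

import Mathlib

noncomputable section

namespace RKCQ

/-- The coefficients of a Runge-Kutta method with `m + 1` stages (the abscissae of the Butcher
tableau play no role for the convolution weights). -/
structure RungeKutta (m : ℕ) where
  A : Matrix (Fin (m + 1)) (Fin (m + 1)) ℝ
  b : Fin (m + 1) → ℝ

/-- The `n`-th coefficient of the power series expansion at `0` of a matrix-valued function. -/
def powerCoeff {ι : Type*} (F : ℂ → Matrix ι ι ℂ) (n : ℕ) : Matrix ι ι ℂ :=
  Matrix.of fun i j => iteratedDeriv n (fun ζ => F ζ i j) 0 / (n.factorial : ℂ)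

/-- `F` is the value `f(M)` of the scalar function `f` at the square matrix `M`: it equals `p(M)` for
a polynomial `p` that agrees with `f` at every eigenvalue of `M`, together with the derivatives of
order less than the algebraic multiplicity of that eigenvalue. -/
def IsMatrixFunction {ι : Type*} [Fintype ι] [DecidableEq ι]
    (f : ℂ → ℂ) (M F : Matrix ι ι ℂ) : Prop :=
  ∃ p : Polynomial ℂ, F = Polynomial.aeval M p ∧
    ∀ (μ : ℂ) (k : ℕ), k < M.charpoly.rootMultiplicity μ →
      (Polynomial.derivative^[k] p).eval μ = iteratedDeriv k f μ

/-- The matrix `f(M)`; a matrix as in `IsMatrixFunction` exists and is unique by Hermite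
interpolation. -/
def matrixFunction {ι : Type*} [Fintype ι] [DecidableEq ι]
    (f : ℂ → ℂ) (M : Matrix ι ι ℂ) : Matrix ι ι ℂ :=
  Classical.epsilon (IsMatrixFunction f M)

/-- `√(z/i) = e^{-iπ/4} √z`, with the principal branch of the square root. -/
def sqrtDivI (z : ℂ) : ℂ :=
  Complex.exp (-(Complex.I * Real.pi / 4)) * z ^ (1 / 2 : ℂ)

/-- The transfer operator of the one-dimensional Schroedinger equation. -/
def transferK (x : ℝ) (z : ℂ) : ℂ :=
  1 / (2 * sqrtDivI z) * Complex.exp (-((|x| : ℝ) : ℂ) * sqrtDivI z)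

/-- The jump of the transfer operator across the negative real axis,
`G(l, x) = K(l e^{-iπ}, x) - K(l e^{iπ}, x)`, in its explicit form. -/
def jumpG (l x : ℝ) : ℂ :=
  Complex.I * Complex.exp (Complex.I * Real.pi / 4) / ((Real.sqrt l : ℝ) : ℂ) *
    Complex.cosh (((|x| : ℝ) : ℂ) * Complex.exp (Complex.I * Real.pi / 4) *
      ((Real.sqrt l : ℝ) : ℂ))

namespace RungeKutta

variable {m : ℕ} (M : RungeKutta m)

/-- The coefficient matrix with complex entries. -/
def Ac : Matrix (Fin (m + 1)) (Fin (m + 1)) ℂ := M.A.map (fun a => (a : ℂ))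

/-- The weight vector with complex entries. -/
def bc : Fin (m + 1) → ℂ := fun i => (M.b i : ℂ)

/-- The row vector `q(z) = bᵀ (I - z A)⁻¹`. -/
def q (z : ℂ) : Fin (m + 1) → ℂ := Matrix.vecMul M.bc (1 - z • M.Ac)⁻¹

/-- The stability function `r(z) = 1 + z bᵀ (I - z A)⁻¹ 𝟙`. -/
def r (z : ℂ) : ℂ := 1 + z * (M.bc ⬝ᵥ Matrix.mulVec (1 - z • M.Ac)⁻¹ 1)

/-- The assumptions on the Runge-Kutta method. -/
structure Admissible : Prop where
  /-- The classical order is at least one (consistency). -/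
  order_one : ∑ i, M.b i = 1
  /-- A-stability: `I - z A` is nonsingular in the closed left half-plane, ... -/
  nonsingular : ∀ z : ℂ, z.re ≤ 0 → IsUnit (1 - z • M.Ac)
  /-- ... and the stability function is bounded by one there. -/
  stable : ∀ z : ℂ, z.re ≤ 0 → ‖M.r z‖ ≤ 1
  strict_on_axis : ∀ y : ℝ, y ≠ 0 → ‖M.r (Complex.I * y)‖ < 1
  invertible : IsUnit M.A
  /-- Stiff accuracy: `bᵀ A⁻¹ = (0, …, 0, 1)`. -/
  stiffly_accurate : Matrix.vecMul M.b M.A⁻¹ = Pi.single (Fin.last m) 1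

/-- The symbol `Δ(ζ) = (A + ζ / (1 - ζ) 𝟙 bᵀ)⁻¹`. -/
def symbol (ζ : ℂ) : Matrix (Fin (m + 1)) (Fin (m + 1)) ℂ :=
  (M.Ac + (ζ / (1 - ζ)) • Matrix.vecMulVec 1 M.bc)⁻¹

/-- The convolution quadrature weight matrices `W_n`: `∑ W_n ζ^n = K(Δ(ζ) / h, x)`. -/
def weightMatrix (h x : ℝ) (n : ℕ) : Matrix (Fin (m + 1)) (Fin (m + 1)) ℂ :=
  powerCoeff (fun ζ => matrixFunction (transferK x) ((h : ℂ)⁻¹ • M.symbol ζ)) n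

/-- The weights `ω_n(x)`, the last row of `W_n`. -/
def omega (h x : ℝ) (n : ℕ) : Fin (m + 1) → ℂ := M.weightMatrix h x n (Fin.last m)

/-- The matrices `E_n(z)`: `∑ E_n(z) ζ^n = (Δ(ζ) - z I)⁻¹`. -/
def resolventMatrix (n : ℕ) (z : ℂ) : Matrix (Fin (m + 1)) (Fin (m + 1)) ℂ :=
  powerCoeff (fun ζ => (M.symbol ζ - z • (1 : Matrix (Fin (m + 1)) (Fin (m + 1)) ℂ))⁻¹) n

/-- The row vector `e_n(z)`, the last row of `E_n(z)`. -/
def e (n : ℕ) (z : ℂ) : Fin (m + 1) → ℂ := M.resolventMatrix n z (Fin.last m)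

/-- The truncated integral `I_n = h / (2πi) ∫_0^ξ G(l, x) e_n(-h l) dl`. -/
def truncatedIntegral (h x ξ : ℝ) (n : ℕ) : Fin (m + 1) → ℂ :=
  ((h : ℂ) / (2 * Real.pi * Complex.I)) •
    ∫ l in (0 : ℝ)..ξ, jumpG l x • M.e n (-((h * l : ℝ) : ℂ))

/-- `γ(ξ)`, the infimum of `log |r(z)| / Re z` over the strip `-ξ ≤ Re z ≤ 0`. The points where the
quotient is not a real number (`Re z = 0` or `r(z) = 0`) are left out; it is `+∞` at those with
`r(z) = 0`, and on the imaginary axis only limits from inside the strip make sense. -/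
def gamma (ξ : ℝ) : ℝ :=
  sInf {t : ℝ | ∃ z : ℂ, -ξ ≤ z.re ∧ z.re < 0 ∧ M.r z ≠ 0 ∧ t = Real.log ‖M.r z‖ / z.re}

/-- `C` can serve as the constant `C_A`, for the vector norm `N`:
`max (|r(z)|, N (q(z))) ≤ C |z|⁻¹` for `Re z ≤ 0`. -/
def IsDecayConstant (N : Seminorm ℂ (Fin (m + 1) → ℂ)) (C : ℝ) : Prop :=
  0 < C ∧ ∀ z : ℂ, z.re ≤ 0 → z ≠ 0 → max ‖M.r z‖ (N (M.q z)) ≤ C * ‖z‖⁻¹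

end RungeKutta

end RKCQ

end

/-!
Stiff accuracy makes `Δ(ζ) - z I` a rank-one perturbation of `A⁻¹ - z I`, and the Sherman-Morrison
formula gives `(1 - ζ r(z))⁻¹ q(z)` for the last row of its inverse; hence `e_n(z) = r(z)ⁿ q(z)`.

Writing `K(Δ(ζ) / h)` as the integral of `K` times the resolvent over the imaginary axis, and
expanding in `ζ`, one gets `ω_n = h / (2π) ∫ K(iy) r(ihy)ⁿ q(ihy) dy`. When the contour is moved to
`Re z = -ξ`, the part of the branch cut that is crossed contributes exactly `I_n`. On the new
contour `|r(hz)| ≤ exp (-hξ γ(hξ))`, `‖q(hz)‖ ≤ C_A |hz|⁻¹` and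
`|K(z)| ≤ exp (d √(ξ/2)) |z|^{-1/2} / 2`, so that the remaining integral is at most a multiple of
`∫ (ξ² + y²)^{-3/4} dy`, a Beta integral, which the reflection formula turns into the `Γ(3/4)`
of the bound.

The infimum `γ` is positive because `r` decays at infinity, so that by the maximum principle `|r|`
is bounded away from `1` on vertical lines in the open left half-plane, and Hadamard's three lines
theorem carries this into the strip.
-/

noncomputable section

open Bornology Complex Filter Matrix MeasureTheory Set Topology

open scoped Matrix.Norms.Operator

namespace RKCQ

section RankOneUpdate

variable {n K : Type*} [Fintype n] [DecidableEq n] [Field K]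

theorem sub_smul_vecMulVec_mul_eq_one {T : Matrix n n K} (hT : IsUnit T) {u w : n → K} {a : K}
    (ha : 1 - a * (w ⬝ᵥ T⁻¹ *ᵥ u) ≠ 0) :
    (T - a • vecMulVec u w) *
      (T⁻¹ + (a / (1 - a * (w ⬝ᵥ T⁻¹ *ᵥ u))) • vecMulVec (T⁻¹ *ᵥ u) (w ᵥ* T⁻¹)) = 1 := by
  have hTT : T * T⁻¹ = 1 := mul_nonsing_inv _ ((isUnit_iff_isUnit_det _).1 hT)
  rw [sub_mul, mul_add, mul_add, hTT, mul_smul_comm, mul_smul_comm, smul_mul_assoc,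
    smul_mul_assoc, mul_vecMulVec, mulVec_mulVec, hTT, one_mulVec, vecMulVec_mul,
    vecMulVec_mul_vecMulVec, vecMulVec_smul]
  set c := w ⬝ᵥ T⁻¹ *ᵥ u
  set V := vecMulVec u (w ᵥ* T⁻¹)
  have hcoeff : a / (1 - a * c) - a - a / (1 - a * c) * (a * c) = 0 := by field_simp; ring
  calc _ = 1 + (a / (1 - a * c) - a - a / (1 - a * c) * (a * c)) • V := by module
    _ = 1 := by rw [hcoeff, zero_smul, add_zero]

theorem inv_sub_smul_vecMulVec {T : Matrix n n K} (hT : IsUnit T) {u w : n → K} {a : K}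
    (ha : 1 - a * (w ⬝ᵥ T⁻¹ *ᵥ u) ≠ 0) :
    (T - a • vecMulVec u w)⁻¹ =
      T⁻¹ + (a / (1 - a * (w ⬝ᵥ T⁻¹ *ᵥ u))) • vecMulVec (T⁻¹ *ᵥ u) (w ᵥ* T⁻¹) :=
  inv_eq_right_inv (sub_smul_vecMulVec_mul_eq_one hT ha)

theorem isUnit_sub_smul_vecMulVec {T : Matrix n n K} (hT : IsUnit T) {u w : n → K} {a : K}
    (ha : 1 - a * (w ⬝ᵥ T⁻¹ *ᵥ u) ≠ 0) : IsUnit (T - a • vecMulVec u w) :=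
  IsUnit.of_mul_eq_one _ (sub_smul_vecMulVec_mul_eq_one hT ha)

theorem vecMul_inv_sub_smul_vecMulVec {T : Matrix n n K} (hT : IsUnit T) {u w : n → K} {a : K}
    (ha : 1 - a * (w ⬝ᵥ T⁻¹ *ᵥ u) ≠ 0) :
    w ᵥ* (T - a • vecMulVec u w)⁻¹ = (1 - a * (w ⬝ᵥ T⁻¹ *ᵥ u))⁻¹ • (w ᵥ* T⁻¹) := by
  rw [inv_sub_smul_vecMulVec hT ha, vecMul_add, vecMul_smul, vecMul_vecMulVec]
  set c := w ⬝ᵥ T⁻¹ *ᵥ u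
  have hcoeff : 1 + a / (1 - a * c) * c = (1 - a * c)⁻¹ := by field_simp; ring
  rw [← hcoeff, add_smul, one_smul, smul_smul]

end RankOneUpdate

namespace RungeKutta

/-- A-stability: the two conditions of `Admissible` on the closed left half-plane. -/
structure IsAStable {m : ℕ} (M : RungeKutta m) : Prop where
  nonsingular : ∀ z : ℂ, z.re ≤ 0 → IsUnit (1 - z • M.Ac)
  stable : ∀ z : ℂ, z.re ≤ 0 → ‖M.r z‖ ≤ 1

/-- Stiff accuracy, `bᵀ A⁻¹ = (0, …, 0, 1)` with `A` invertible. -/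
structure IsStifflyAccurate {m : ℕ} (M : RungeKutta m) : Prop where
  invertible : IsUnit M.A
  stiffly_accurate : M.b ᵥ* M.A⁻¹ = Pi.single (Fin.last m) 1

variable {m : ℕ} {M : RungeKutta m} {z ζ : ℂ}

theorem Admissible.isAStable (hM : M.Admissible) : M.IsAStable :=
  ⟨hM.nonsingular, hM.stable⟩

theorem Admissible.isStifflyAccurate (hM : M.Admissible) : M.IsStifflyAccurate :=
  ⟨hM.invertible, hM.stiffly_accurate⟩

namespace IsStifflyAccurate

theorem isUnit_Ac (hS : M.IsStifflyAccurate) : IsUnit M.Ac :=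
  hS.invertible.map Complex.ofRealHom.mapMatrix

theorem mul_inv_Ac (hS : M.IsStifflyAccurate) : M.Ac * M.Ac⁻¹ = 1 :=
  mul_nonsing_inv _ ((isUnit_iff_isUnit_det _).1 hS.isUnit_Ac)

theorem inv_mul_Ac (hS : M.IsStifflyAccurate) : M.Ac⁻¹ * M.Ac = 1 :=
  nonsing_inv_mul _ ((isUnit_iff_isUnit_det _).1 hS.isUnit_Ac)

theorem bc_eq (hS : M.IsStifflyAccurate) : M.bc = M.Ac.row (Fin.last m) := by
  have hb : M.b = M.A.row (Fin.last m) := by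
    rw [← single_one_vecMul, ← hS.stiffly_accurate, vecMul_vecMul,
      nonsing_inv_mul _ ((isUnit_iff_isUnit_det _).1 hS.invertible), vecMul_one]
  ext j
  simp [bc, Ac, hb, row]

theorem bc_vecMul_inv (hS : M.IsStifflyAccurate) :
    M.bc ᵥ* M.Ac⁻¹ = Pi.single (Fin.last m) 1 := by
  rw [hS.bc_eq, ← single_one_vecMul, vecMul_vecMul, hS.mul_inv_Ac, vecMul_one]

theorem symbol_eq (hS : M.IsStifflyAccurate) (hζ : ζ ≠ 1) :
    M.symbol ζ = M.Ac⁻¹ - ζ • vecMulVec (M.Ac⁻¹ *ᵥ 1) (Pi.single (Fin.last m) 1) := by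
  have hζ' : 1 - ζ ≠ 0 := sub_ne_zero.2 hζ.symm
  have hdot : M.bc ⬝ᵥ M.Ac⁻¹ *ᵥ 1 = 1 := by simp [dotProduct_mulVec, hS.bc_vecMul_inv]
  have hne : 1 - -(ζ / (1 - ζ)) * (M.bc ⬝ᵥ M.Ac⁻¹ *ᵥ 1) ≠ 0 := by
    rw [hdot]
    field_simp
    simpa using hζ'
  have hcoeff : -(ζ / (1 - ζ)) / (1 - -(ζ / (1 - ζ)) * 1) = -ζ := by field_simp; ring
  rw [symbol, ← sub_neg_eq_add, ← neg_smul, inv_sub_smul_vecMulVec hS.isUnit_Ac hne, hdot, hcoeff,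
    hS.bc_vecMul_inv, neg_smul, ← sub_eq_add_neg]

theorem q_eq (hS : M.IsStifflyAccurate) : M.q z = (M.Ac * (1 - z • M.Ac)⁻¹).row (Fin.last m) := by
  rw [q, hS.bc_eq, ← single_one_vecMul, vecMul_vecMul, single_one_vecMul]

theorem r_eq (hS : M.IsStifflyAccurate) (hz : IsUnit (1 - z • M.Ac)) :
    M.r z = ((1 - z • M.Ac)⁻¹ *ᵥ 1) (Fin.last m) := by
  set P := (1 - z • M.Ac)⁻¹ with hP
  have hinv : (1 - z • M.Ac) * P = 1 := mul_nonsing_inv _ ((isUnit_iff_isUnit_det _).1 hz)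
  have hP' : P = 1 + z • (M.Ac * P) := by
    rw [sub_mul, one_mul, smul_mul_assoc] at hinv
    rw [← hinv, sub_add_cancel]
  conv_rhs => rw [hP']
  simp only [r, hS.bc_eq, add_mulVec, one_mulVec, smul_mulVec, ← mulVec_mulVec, Pi.add_apply,
    Pi.smul_apply, Pi.one_apply, smul_eq_mul, ← hP]
  rfl

theorem inv_Ac_sub_eq_mul (hS : M.IsStifflyAccurate) :
    M.Ac⁻¹ - z • 1 = (1 - z • M.Ac) * M.Ac⁻¹ := by
  rw [sub_mul, one_mul, smul_mul_assoc, hS.mul_inv_Ac]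

theorem isUnit_inv_Ac_sub (hS : M.IsStifflyAccurate) (hz : IsUnit (1 - z • M.Ac)) :
    IsUnit (M.Ac⁻¹ - z • 1) := by
  rw [hS.inv_Ac_sub_eq_mul]
  exact hz.mul (isUnit_nonsing_inv_iff.2 hS.isUnit_Ac)

theorem inv_inv_Ac_sub (hS : M.IsStifflyAccurate) :
    (M.Ac⁻¹ - z • 1)⁻¹ = M.Ac * (1 - z • M.Ac)⁻¹ := by
  rw [hS.inv_Ac_sub_eq_mul, Matrix.mul_inv_rev,
    nonsing_inv_nonsing_inv _ ((isUnit_iff_isUnit_det _).1 hS.isUnit_Ac)]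

theorem single_vecMul_inv_inv_Ac_sub (hS : M.IsStifflyAccurate) :
    Pi.single (Fin.last m) 1 ᵥ* (M.Ac⁻¹ - z • 1)⁻¹ = M.q z := by
  rw [hS.inv_inv_Ac_sub, hS.q_eq, single_one_vecMul]

theorem single_dotProduct_inv_inv_Ac_sub (hS : M.IsStifflyAccurate)
    (hz : IsUnit (1 - z • M.Ac)) :
    Pi.single (Fin.last m) 1 ⬝ᵥ (M.Ac⁻¹ - z • 1)⁻¹ *ᵥ (M.Ac⁻¹ *ᵥ 1) = M.r z := by
  have h : M.Ac⁻¹ - z • 1 = M.Ac⁻¹ * (1 - z • M.Ac) := by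
    rw [mul_sub, mul_one, mul_smul_comm, hS.inv_mul_Ac]
  rw [mulVec_mulVec, h, Matrix.mul_inv_rev, nonsing_inv_nonsing_inv _
    ((isUnit_iff_isUnit_det _).1 hS.isUnit_Ac), mul_assoc, hS.mul_inv_Ac, mul_one,
    single_one_dotProduct, hS.r_eq hz]

theorem isUnit_symbol_sub (hS : M.IsStifflyAccurate) (hz : IsUnit (1 - z • M.Ac)) (hζ : ζ ≠ 1)
    (hr : 1 - ζ * M.r z ≠ 0) : IsUnit (M.symbol ζ - z • 1) := by
  rw [hS.symbol_eq hζ, sub_right_comm]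
  exact isUnit_sub_smul_vecMulVec (hS.isUnit_inv_Ac_sub hz)
    (by rwa [hS.single_dotProduct_inv_inv_Ac_sub hz])

theorem symbol_sub_inv_last (hS : M.IsStifflyAccurate) (hz : IsUnit (1 - z • M.Ac))
    (hζ : ζ ≠ 1) (hr : 1 - ζ * M.r z ≠ 0) :
    (M.symbol ζ - z • 1)⁻¹.row (Fin.last m) = (1 - ζ * M.r z)⁻¹ • M.q z := by
  have hdot := hS.single_dotProduct_inv_inv_Ac_sub hz
  rw [← single_one_vecMul, hS.symbol_eq hζ, sub_right_comm, vecMul_inv_sub_smul_vecMulVec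
    (hS.isUnit_inv_Ac_sub hz) (by rwa [hdot]), hdot, hS.single_vecMul_inv_inv_Ac_sub]

end IsStifflyAccurate

end RungeKutta

section Growth

variable {E F : Type*} [NormedAddCommGroup E] [ProperSpace E] [NormedAddCommGroup F]

theorem exists_norm_le_mul_of_isBigO {S : Set E} (hS : IsClosed S) {f : E → F}
    (hf : ContinuousOn f (S \ {0})) {φ : ℝ → ℝ} (hφ : ContinuousOn φ (Ioi 0))
    (hpos : ∀ t, 0 < t → 0 < φ t) (hzero : f =O[𝓝[S \ {0}] 0] fun z => φ ‖z‖)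
    (hinf : f =O[cobounded E ⊓ 𝓟 S] fun z => φ ‖z‖) :
    ∃ C, 0 < C ∧ ∀ z ∈ S, z ≠ 0 → ‖f z‖ ≤ C * φ ‖z‖ := by
  obtain ⟨C₀, hC₀, h₀⟩ := hzero.exists_pos
  obtain ⟨C₁, -, h₁⟩ := hinf.exists_pos
  obtain ⟨δ, hδ, hδS⟩ := Metric.mem_nhdsWithin_iff.1 h₀.bound
  obtain ⟨R, hR⟩ : ∃ R, ∀ z ∈ S, R ≤ ‖z‖ → ‖f z‖ ≤ C₁ * ‖φ ‖z‖‖ := by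
    obtain ⟨R, -, hR⟩ := hasBasis_cobounded_norm.mem_iff.1 (eventually_inf_principal.1 h₁.bound)
    exact ⟨R, fun z hz hzR => hR hzR hz⟩
  have hK : IsCompact (S ∩ Metric.closedBall 0 R ∩ (Metric.ball 0 δ)ᶜ) :=
    ((isCompact_closedBall 0 R).inter_left hS).inter_right Metric.isOpen_ball.isClosed_compl
  have hne : ∀ z ∈ S ∩ Metric.closedBall 0 R ∩ (Metric.ball 0 δ)ᶜ, z ≠ 0 := by
    rintro _ hz rfl
    exact hz.2 (Metric.mem_ball_self hδ)
  obtain ⟨C₂, h₂⟩ := hK.exists_bound_of_continuousOn (f := fun z => (φ ‖z‖)⁻¹ * ‖f z‖)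
    (((hφ.comp continuous_norm.continuousOn fun z hz => norm_pos_iff.2 (hne z hz)).inv₀
      fun z hz => (hpos _ (norm_pos_iff.2 (hne z hz))).ne').mul
        (hf.mono fun z hz => ⟨hz.1.1, hne z hz⟩).norm)
  refine ⟨max C₀ (max C₁ C₂), lt_max_of_lt_left hC₀, fun z hzS hz => ?_⟩
  have hφz := hpos _ (norm_pos_iff.2 hz)
  rw [← Real.norm_of_nonneg hφz.le]
  by_cases hzδ : z ∈ Metric.ball 0 δ
  · exact (hδS ⟨hzδ, hzS, hz⟩).trans (by gcongr; exact le_max_left _ _)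
  rcases le_total R ‖z‖ with hzR | hzR
  · refine (hR z hzS hzR).trans ?_
    gcongr
    exact (le_max_left _ _).trans (le_max_right _ _)
  · have hle := (le_abs_self _).trans (h₂ z ⟨⟨hzS, by simpa using hzR⟩, hzδ⟩)
    rw [inv_mul_le_iff₀ hφz, mul_comm] at hle
    rw [Real.norm_of_nonneg hφz.le]
    refine hle.trans ?_
    gcongr
    exact (le_max_right _ _).trans (le_max_right _ _)

end Growth

theorem exists_seminorm_le_mul_norm {E : Type*} [NormedAddCommGroup E] [NormedSpace ℂ E]
    [FiniteDimensional ℂ E] (p : Seminorm ℂ E) : ∃ C, 0 < C ∧ ∀ v, p v ≤ C * ‖v‖ := by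
  have : FiniteDimensional ℝ E := FiniteDimensional.complexToReal E
  have hp : Continuous p := continuousOn_univ.1 (p.convexOn.continuousOn isOpen_univ)
  exact p.bound_of_continuous_normedSpace hp

theorem powerCoeff_row_of_hasSum {ι : Type*} {F : ℂ → Matrix ι ι ℂ} {i : ι} {c : ℕ → ι → ℂ}
    (hF : ∀ ζ : ℂ, ‖ζ‖ < 1 → HasSum (fun n => ζ ^ n • c n) ((F ζ).row i)) (n : ℕ) :
    (powerCoeff F n).row i = c n := by
  ext j
  have hpow : HasFPowerSeriesAt (fun ζ => F ζ i j)
      (FormalMultilinearSeries.ofScalars ℂ fun n => c n j) 0 := by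
    rw [hasFPowerSeriesAt_iff]
    filter_upwards [Metric.ball_mem_nhds (0 : ℂ) one_pos] with ζ hζ
    simpa [FormalMultilinearSeries.coeff_ofScalars] using
      Pi.hasSum.1 (hF ζ (by simpa using hζ)) j
  have hcoeff := congrArg (fun p => FormalMultilinearSeries.coeff p n)
    (hpow.eq_formalMultilinearSeries hpow.analyticAt.hasFPowerSeriesAt)
  simpa [FormalMultilinearSeries.coeff_ofScalars, powerCoeff] using hcoeff.symm

namespace RungeKutta

variable {m : ℕ} {M : RungeKutta m} {z ζ : ℂ}

theorem IsStifflyAccurate.inv_one_sub_smul_Ac (hS : M.IsStifflyAccurate) :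
    (1 - z • M.Ac)⁻¹ = -(resolvent M.Ac⁻¹ z * M.Ac⁻¹) := by
  have h : 1 - z • M.Ac = -M.Ac * (z • 1 - M.Ac⁻¹) := by
    rw [mul_sub, mul_smul_comm, mul_one, neg_mul, hS.mul_inv_Ac, smul_neg]
    abel
  have hneg : (-M.Ac)⁻¹ = -M.Ac⁻¹ := inv_eq_right_inv (by rw [neg_mul_neg, hS.mul_inv_Ac])
  rw [h, Matrix.mul_inv_rev, hneg, mul_neg, resolvent, Algebra.algebraMap_eq_smul_one,
    nonsing_inv_eq_ringInverse (_ - _)]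

theorem IsStifflyAccurate.inv_one_sub_smul_Ac_isBigO (hS : M.IsStifflyAccurate) :
    (fun z : ℂ => (1 - z • M.Ac)⁻¹) =O[cobounded ℂ] fun z => ‖z‖⁻¹ := by
  simp only [hS.inv_one_sub_smul_Ac]
  simpa using ((spectrum.resolvent_isBigO_inv M.Ac⁻¹).mul
    (Asymptotics.isBigO_const_const M.Ac⁻¹ (one_ne_zero (α := ℂ)) _)).norm_right.neg_left

theorem differentiableAt_inv_one_sub_smul_Ac (hz : IsUnit (1 - z • M.Ac)) :
    DifferentiableAt ℂ (fun w : ℂ => (1 - w • M.Ac)⁻¹) z := by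
  simp only [nonsing_inv_eq_ringInverse]
  exact DifferentiableAt.inverse (by fun_prop) hz

theorem r_eq_add_dotProduct : M.r z = 1 + z * (M.q z ⬝ᵥ 1) := by
  rw [r, q, dotProduct_mulVec]

theorem differentiableAt_q (hz : IsUnit (1 - z • M.Ac)) : DifferentiableAt ℂ M.q z :=
  ((vecMulBilin ℂ ℂ M.bc).toContinuousLinearMap.differentiableAt).comp z
    (differentiableAt_inv_one_sub_smul_Ac hz)

theorem differentiableAt_r (hz : IsUnit (1 - z • M.Ac)) : DifferentiableAt ℂ M.r z := by
  have hq := differentiableAt_pi.1 (differentiableAt_q hz)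
  simp only [funext fun z => r_eq_add_dotProduct (M := M) (z := z), dotProduct]
  fun_prop

theorem exists_norm_inv_one_sub_smul_Ac_le (hA : M.IsAStable) (hS : M.IsStifflyAccurate) :
    ∃ C, 0 < C ∧ ∀ z : ℂ, z.re ≤ 0 → z ≠ 0 → ‖(1 - z • M.Ac)⁻¹‖ ≤ C * (1 + ‖z‖)⁻¹ := by
  have hcont : ContinuousOn (fun z : ℂ => (1 - z • M.Ac)⁻¹) {z | z.re ≤ 0} := fun z hz =>
    (differentiableAt_inv_one_sub_smul_Ac (hA.nonsingular z hz)).continuousAt.continuousWithinAt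
  have hpos : ∀ t : ℝ, 0 < t → 0 < (1 + t)⁻¹ := fun t ht => by positivity
  refine exists_norm_le_mul_of_isBigO (isClosed_le continuous_re continuous_const)
    (hcont.mono sdiff_subset) (φ := fun t => (1 + t)⁻¹) ?_ hpos ?_ ?_
  · exact ContinuousOn.inv₀ (by fun_prop) fun t ht => (add_pos one_pos ht).ne'
  · refine (((hcont 0 (by simp)).mono_left (nhdsWithin_mono _ sdiff_subset)).isBigO_one ℝ).trans ?_
    refine Asymptotics.IsBigO.of_bound 2 ?_
    filter_upwards [nhdsWithin_le_nhds (Metric.ball_mem_nhds (0 : ℂ) one_pos)] with z hz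
    have hz' : ‖z‖ < 1 := by simpa using hz
    rw [norm_one, Real.norm_of_nonneg (by positivity), ← div_eq_mul_inv,
      le_div_iff₀ (by positivity)]
    linarith
  · refine (hS.inv_one_sub_smul_Ac_isBigO.trans ?_).mono inf_le_left
    refine Asymptotics.IsBigO.of_bound 2 ?_
    filter_upwards [eventually_cobounded_le_norm 1] with z hz
    rw [norm_inv, norm_norm, Real.norm_of_nonneg (by positivity), ← div_eq_mul_inv,
      inv_eq_one_div, div_le_div_iff₀ (by linarith) (by positivity)]
    linarith

theorem exists_norm_q_le (hA : M.IsAStable) (hS : M.IsStifflyAccurate) :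
    ∃ C, 0 < C ∧ ∀ z : ℂ, z.re ≤ 0 → z ≠ 0 → ‖M.q z‖ ≤ C * (1 + ‖z‖)⁻¹ := by
  obtain ⟨C, hC, hbound⟩ := exists_norm_inv_one_sub_smul_Ac_le hA hS
  obtain ⟨B, hB, hq⟩ := exists_seminorm_le_mul_norm
    ((normSeminorm ℂ (Fin (m + 1) → ℂ)).comp (vecMulBilin ℂ ℂ M.bc))
  refine ⟨B * C, by positivity, fun z hz hz0 => (hq (1 - z • M.Ac)⁻¹).trans ?_⟩
  rw [mul_assoc]
  gcongr
  exact hbound z hz hz0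

theorem exists_norm_r_le (hA : M.IsAStable) (hS : M.IsStifflyAccurate) :
    ∃ C, 0 < C ∧ ∀ z : ℂ, z.re ≤ 0 → z ≠ 0 → ‖M.r z‖ ≤ C * ‖z‖⁻¹ := by
  obtain ⟨C, hC, hbound⟩ := exists_norm_inv_one_sub_smul_Ac_le hA hS
  refine ⟨C, hC, fun z hz hz0 => ?_⟩
  have hz0' := norm_pos_iff.2 hz0
  calc ‖M.r z‖ ≤ ‖(1 - z • M.Ac)⁻¹ *ᵥ 1‖ := by
        rw [hS.r_eq (hA.nonsingular z hz)]
        exact norm_le_pi_norm _ _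
    _ ≤ ‖(1 - z • M.Ac)⁻¹‖ * ‖(1 : Fin (m + 1) → ℂ)‖ := linfty_opNorm_mulVec _ _
    _ ≤ C * ‖z‖⁻¹ := by
        rw [norm_one, mul_one]
        refine (hbound z hz hz0).trans ?_
        gcongr
        exact le_add_of_nonneg_left zero_le_one

theorem exists_isDecayConstant (hA : M.IsAStable) (hS : M.IsStifflyAccurate)
    (N : Seminorm ℂ (Fin (m + 1) → ℂ)) : ∃ C, M.IsDecayConstant N C := by
  obtain ⟨Cr, hCr, hr⟩ := exists_norm_r_le hA hS
  obtain ⟨Cq, hCq, hq⟩ := exists_norm_q_le hA hS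
  obtain ⟨CN, hCN, hN⟩ := exists_seminorm_le_mul_norm N
  refine ⟨max Cr (CN * Cq), lt_max_of_lt_left hCr, fun z hz hz0 => max_le ?_ ?_⟩
  · exact (hr z hz hz0).trans (by gcongr; exact le_max_left _ _)
  · have hz0' := norm_pos_iff.2 hz0
    calc N (M.q z) ≤ CN * (Cq * (1 + ‖z‖)⁻¹) := (hN _).trans (by gcongr; exact hq z hz hz0)
      _ ≤ max Cr (CN * Cq) * ‖z‖⁻¹ := by
          rw [← mul_assoc]
          gcongr
          exacts [le_max_right _ _, le_add_of_nonneg_left zero_le_one]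

theorem norm_mul_r_lt_one (hA : M.IsAStable) (hζ : ‖ζ‖ < 1) (hz : z.re ≤ 0) :
    ‖ζ * M.r z‖ < 1 := by
  rw [norm_mul]
  exact mul_lt_one_of_nonneg_of_lt_one_left (norm_nonneg ζ) hζ (hA.stable z hz)

theorem one_sub_mul_r_ne_zero (hA : M.IsAStable) (hζ : ‖ζ‖ < 1) (hz : z.re ≤ 0) :
    1 - ζ * M.r z ≠ 0 := fun h => by
  have hlt := norm_mul_r_lt_one hA hζ hz
  rw [← sub_eq_zero.1 h, norm_one] at hlt
  exact lt_irrefl _ hlt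

theorem isUnit_symbol_sub (hA : M.IsAStable) (hS : M.IsStifflyAccurate) (hζ : ‖ζ‖ < 1)
    (hz : z.re ≤ 0) : IsUnit (M.symbol ζ - z • 1) :=
  hS.isUnit_symbol_sub (hA.nonsingular z hz) (by rintro rfl; simp at hζ)
    (one_sub_mul_r_ne_zero hA hζ hz)

theorem hasSum_symbol_sub_inv_last (hA : M.IsAStable) (hS : M.IsStifflyAccurate) (hζ : ‖ζ‖ < 1)
    (hz : z.re ≤ 0) :
    HasSum (fun n => ζ ^ n • (M.r z ^ n • M.q z)) ((M.symbol ζ - z • 1)⁻¹.row (Fin.last m)) := by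
  rw [hS.symbol_sub_inv_last (hA.nonsingular z hz) (by rintro rfl; simp at hζ)
    (one_sub_mul_r_ne_zero hA hζ hz)]
  simpa only [smul_smul, mul_pow] using
    (hasSum_geometric_of_norm_lt_one (norm_mul_r_lt_one hA hζ hz)).smul_const (M.q z)

theorem e_eq (hA : M.IsAStable) (hS : M.IsStifflyAccurate) (n : ℕ) (hz : z.re ≤ 0) :
    M.e n z = M.r z ^ n • M.q z :=
  powerCoeff_row_of_hasSum (fun _ hζ => hasSum_symbol_sub_inv_last hA hS hζ hz) n

end RungeKutta

namespace RungeKutta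

variable {m : ℕ} {M : RungeKutta m} {z : ℂ} {a : ℝ}

theorem norm_r_lt_one (hA : M.IsAStable) (hS : M.IsStifflyAccurate) (hz : z.re < 0) :
    ‖M.r z‖ < 1 := by
  refine (hA.stable z hz.le).lt_of_ne fun hone => ?_
  obtain ⟨C, hC, hdecay⟩ := exists_norm_r_le hA hS
  have hmax : IsMaxOn (norm ∘ M.r) {w | w.re < 0} z := fun w hw => by
    simpa [hone] using hA.stable w (le_of_lt hw)
  have hmem : ((-(C + 1) : ℝ) : ℂ) ∈ {w : ℂ | w.re < 0} := by
    rw [mem_ofPred_eq, ofReal_re]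
    linarith
  have hconst := norm_eqOn_of_isPreconnected_of_isMaxOn
    (convex_halfSpace_re_lt 0).isPreconnected (isOpen_lt continuous_re continuous_const)
    (fun w hw => (differentiableAt_r (hA.nonsingular w (le_of_lt hw))).differentiableWithinAt)
    hz hmax hmem
  have hle := hdecay _ (le_of_lt hmem) (ofReal_ne_zero.2 (by linarith))
  rw [show ‖M.r _‖ = ‖M.r z‖ from hconst, hone, norm_real, norm_neg,
    Real.norm_of_nonneg (by positivity), ← div_eq_mul_inv, le_div_iff₀ (by positivity)] at hle
  linarith

theorem exists_norm_r_le_lt_one (hA : M.IsAStable) (hS : M.IsStifflyAccurate) (ha : 0 < a) :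
    ∃ ρ, 0 < ρ ∧ ρ < 1 ∧ ∀ z : ℂ, z.re = -a → ‖M.r z‖ ≤ ρ := by
  obtain ⟨C, -, hdecay⟩ := exists_norm_r_le hA hS
  have hK : IsCompact (Metric.closedBall 0 (max (2 * C) a) ∩ {z : ℂ | z.re = -a}) :=
    (isCompact_closedBall _ _).inter_right (isClosed_eq continuous_re continuous_const)
  have hneg : ∀ z : ℂ, z.re = -a → z.re < 0 := fun z hz => by rw [hz]; linarith
  obtain ⟨z₀, hz₀, hmax⟩ := hK.exists_isMaxOn (f := fun z => ‖M.r z‖)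
    ⟨((-a : ℝ) : ℂ), by simp [abs_of_pos ha]⟩ fun z hz =>
      (differentiableAt_r (hA.nonsingular z (hneg z hz.2).le)).continuousAt.norm.continuousWithinAt
  refine ⟨max ‖M.r z₀‖ (1 / 2), by positivity,
    max_lt (norm_r_lt_one hA hS (hneg _ hz₀.2)) (by norm_num), fun z hz => ?_⟩
  rcases le_total ‖z‖ (max (2 * C) a) with hle | hle
  · exact (hmax ⟨by simpa using hle, hz⟩).trans (le_max_left _ _)
  · have h2C : 2 * C ≤ ‖z‖ := (le_max_left _ _).trans hle
    have hz0 : 0 < ‖z‖ := ha.trans_le ((le_max_right _ _).trans hle)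
    refine ((hdecay z (hneg z hz).le (norm_pos_iff.1 hz0)).trans ?_).trans (le_max_right _ _)
    rw [← div_eq_mul_inv, div_le_iff₀ hz0]
    linarith

theorem norm_r_le_rpow (hA : M.IsAStable) {ρ : ℝ} (ha : 0 < a)
    (hρ : ∀ z : ℂ, z.re = -a → ‖M.r z‖ ≤ ρ) (hz₁ : -a ≤ z.re) (hz₂ : z.re ≤ 0) :
    ‖M.r z‖ ≤ ρ ^ (-z.re / a) := by
  have hcont : ContinuousOn M.r {z | z.re ≤ 0} := fun w hw =>
    (differentiableAt_r (hA.nonsingular w hw)).continuousAt.continuousWithinAt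
  have hclosure : closure (HadamardThreeLines.verticalStrip (-a) 0) ⊆ {z | z.re ≤ 0} :=
    closure_minimal (fun w hw => hw.2.le) (isClosed_le continuous_re continuous_const)
  have hdiff : DiffContOnCl ℂ M.r (HadamardThreeLines.verticalStrip (-a) 0) :=
    ⟨fun w hw => (differentiableAt_r (hA.nonsingular w hw.2.le)).differentiableWithinAt,
      hcont.mono hclosure⟩
  have hinterp := HadamardThreeLines.norm_le_interp_of_mem_verticalClosedStrip' (b := 1)
    (by linarith) ⟨hz₁, hz₂⟩ hdiff ⟨1, by rintro _ ⟨w, hw, rfl⟩; exact hA.stable w hw.2⟩ hρ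
    fun w hw => hA.stable w (le_of_eq hw)
  have hexp : 1 - (z.re - -a) / (0 - -a) = -z.re / a := by
    rw [sub_neg_eq_add, zero_sub, neg_neg]
    field_simp
    ring
  rwa [Real.one_rpow, mul_one, hexp] at hinterp

theorem exists_le_log_norm_r_div (hA : M.IsAStable) (hS : M.IsStifflyAccurate) (ha : 0 < a) :
    ∃ c, 0 < c ∧ ∀ z : ℂ, -a ≤ z.re → z.re < 0 → M.r z ≠ 0 → c ≤ Real.log ‖M.r z‖ / z.re := by
  obtain ⟨ρ, hρ₀, hρ₁, hρ⟩ := exists_norm_r_le_lt_one hA hS ha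
  refine ⟨-Real.log ρ / a, div_pos (neg_pos.2 (Real.log_neg hρ₀ hρ₁)) ha,
    fun z hz₁ hz₂ hr => ?_⟩
  have hlog := Real.log_le_log (norm_pos_iff.2 hr) (norm_r_le_rpow hA ha hρ hz₁ hz₂.le)
  rw [Real.log_rpow hρ₀] at hlog
  rw [le_div_iff_of_neg hz₂]
  exact (le_of_eq (by ring)).trans' hlog

theorem exists_r_ne_zero (ha : 0 < a) : ∃ z : ℂ, -a ≤ z.re ∧ z.re < 0 ∧ M.r z ≠ 0 := by
  have hcont : ContinuousAt (fun t : ℝ => M.r t) 0 :=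
    (differentiableAt_r (by simp)).continuousAt.comp continuous_ofReal.continuousAt
  have hev := hcont.eventually_ne (y := 0) (by simp [r])
  obtain ⟨t, ht, hta, ht0⟩ :=
    ((hev.filter_mono nhdsWithin_le_nhds).and (Ioo_mem_nhdsLT (neg_lt_zero.2 ha))).exists
  exact ⟨t, by simpa using hta.le, by simpa using ht0, ht⟩

theorem gamma_pos (hA : M.IsAStable) (hS : M.IsStifflyAccurate) (ha : 0 < a) :
    0 < M.gamma a := by
  obtain ⟨c, hc, hle⟩ := exists_le_log_norm_r_div hA hS ha
  obtain ⟨z, hz₁, hz₂, hr⟩ := exists_r_ne_zero (M := M) ha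
  refine hc.trans_le (le_csInf ⟨_, z, hz₁, hz₂, hr, rfl⟩ ?_)
  rintro _ ⟨w, hw₁, hw₂, hw, rfl⟩
  exact hle w hw₁ hw₂ hw

theorem norm_r_le_exp (hA : M.IsAStable) (ha : 0 < a) (hz : z.re = -a) :
    ‖M.r z‖ ≤ Real.exp (-(a * M.gamma a)) := by
  by_cases hr : M.r z = 0
  · rw [hr, norm_zero]
    positivity
  have hz₂ : z.re < 0 := by rw [hz]; linarith
  have hgamma : M.gamma a ≤ Real.log ‖M.r z‖ / z.re := by
    refine csInf_le ⟨0, ?_⟩ ⟨z, hz.ge, hz₂, hr, rfl⟩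
    rintro _ ⟨w, -, hw, -, rfl⟩
    exact div_nonneg_of_nonpos (Real.log_nonpos (norm_nonneg _) (hA.stable w hw.le)) hw.le
  rw [le_div_iff_of_neg hz₂, hz] at hgamma
  rw [← Real.log_le_iff_le_exp (norm_pos_iff.2 hr)]
  linarith

end RungeKutta

section Interpolation

open Polynomial

theorem exists_newton_interpolation {U : Set ℂ} (hU : IsOpen U) (s : Multiset ℂ)
    (hs : ∀ a ∈ s, a ∈ U) {f : ℂ → ℂ} (hf : DifferentiableOn ℂ f U) :
    ∃ (p : ℂ[X]) (g : ℂ → ℂ), DifferentiableOn ℂ g U ∧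
      ∀ z ∈ U, f z = p.eval z + g z * (s.map fun a => X - C a).prod.eval z := by
  induction s using Multiset.induction_on with
  | empty => exact ⟨0, f, hf, by simp⟩
  | cons a s ih =>
    obtain ⟨p, g, hg, hfg⟩ := ih fun b hb => hs b (Multiset.mem_cons_of_mem hb)
    have ha : U ∈ 𝓝 a := hU.mem_nhds (hs a (Multiset.mem_cons_self a s))
    refine ⟨p + C (g a) * (s.map fun a => X - C a).prod, dslope g a,
      (differentiableOn_dslope ha).2 hg, fun z hz => ?_⟩
    have hslope : (z - a) * dslope g a z = g z - g a := sub_smul_dslope g a z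
    rw [hfg z hz]
    simp only [Multiset.map_cons, Multiset.prod_cons, eval_mul, eval_add, eval_C, eval_sub, eval_X]
    linear_combination -(s.map fun a => X - C a).prod.eval z * hslope

theorem iteratedDeriv_eval (p : ℂ[X]) (k : ℕ) :
    iteratedDeriv k (fun z => p.eval z) = fun z => (derivative^[k] p).eval z := by
  induction k with
  | zero => simp
  | succ k ih =>
    rw [iteratedDeriv_succ, ih, Function.iterate_succ_apply']
    ext z
    simp

theorem analyticAt_eval (p : ℂ[X]) (z : ℂ) : AnalyticAt ℂ (fun w => p.eval w) z := by
  simpa using (analyticAt_id (𝕜 := ℂ) (z := z)).aeval_polynomial p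

theorem iterate_derivative_eval_eq {f g : ℂ → ℂ} {p χ : ℂ[X]} {μ : ℂ} (hf : AnalyticAt ℂ f μ)
    (hg : AnalyticAt ℂ g μ) (hfg : ∀ᶠ z in 𝓝 μ, f z = p.eval z + g z * χ.eval z) {k : ℕ}
    (hk : k < χ.rootMultiplicity μ) : (derivative^[k] p).eval μ = iteratedDeriv k f μ := by
  have hp := analyticAt_eval p μ
  obtain ⟨q, hq⟩ := χ.pow_rootMultiplicity_dvd μ
  have horder : (χ.rootMultiplicity μ : ℕ∞) ≤ analyticOrderAt (f - fun z => p.eval z) μ := by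
    rw [natCast_le_analyticOrderAt (hf.sub hp)]
    refine ⟨fun z => g z * q.eval z, hg.mul (analyticAt_eval q μ), ?_⟩
    filter_upwards [hfg] with z hz
    have hχ := congrArg (eval z) hq
    simp only [eval_mul, eval_pow, eval_sub, eval_X, eval_C] at hχ
    rw [Pi.sub_apply, hz, smul_eq_mul, hχ]
    ring
  have hzero :=
    (natCast_le_analyticOrderAt_iff_iteratedDeriv_eq_zero (hf.sub hp)).1 horder k hk
  rw [iteratedDeriv_sub hf.contDiffAt hp.contDiffAt, iteratedDeriv_eval, sub_eq_zero] at hzero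
  exact hzero.symm

section MatrixFunction

variable {ι : Type*} [Fintype ι] [DecidableEq ι]

theorem exists_isMatrixFunction {U : Set ℂ} (hU : IsOpen U) {f : ℂ → ℂ}
    (hf : DifferentiableOn ℂ f U) {B : Matrix ι ι ℂ} (hB : ∀ a, B.charpoly.IsRoot a → a ∈ U) :
    ∃ (p : ℂ[X]) (g : ℂ → ℂ), DifferentiableOn ℂ g U ∧
      (∀ z ∈ U, f z = p.eval z + g z * B.charpoly.eval z) ∧ IsMatrixFunction f B (aeval B p) := by
  have hne := B.charpoly_monic.ne_zero
  obtain ⟨p, g, hg, hfg⟩ := exists_newton_interpolation hU B.charpoly.roots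
    (fun a ha => hB a ((mem_roots hne).1 ha)) hf
  rw [← (IsAlgClosed.splits B.charpoly).eq_prod_roots_of_monic B.charpoly_monic] at hfg
  refine ⟨p, g, hg, hfg, p, rfl, fun μ k hk => ?_⟩
  have hμ := hU.mem_nhds (hB μ ((rootMultiplicity_pos hne).1 (Nat.zero_lt_of_lt hk)))
  exact iterate_derivative_eval_eq (hf.analyticAt hμ) (hg.analyticAt hμ)
    (eventually_of_mem hμ hfg) hk

theorem IsMatrixFunction.unique {f : ℂ → ℂ} {B F G : Matrix ι ι ℂ} (hF : IsMatrixFunction f B F)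
    (hG : IsMatrixFunction f B G) : F = G := by
  obtain ⟨p, rfl, hp⟩ := hF
  obtain ⟨q, rfl, hq⟩ := hG
  rw [← sub_eq_zero, ← map_sub]
  by_cases h0 : p - q = 0
  · rw [h0, map_zero]
  have hmult : ∀ μ, B.charpoly.rootMultiplicity μ ≤ (p - q).rootMultiplicity μ := fun μ => by
    by_contra! hlt
    have hroot : ∀ k ≤ (p - q).rootMultiplicity μ, (derivative^[k] (p - q)).IsRoot μ :=
      fun k hk => by
        rw [IsRoot, iterate_derivative_sub, eval_sub, hp μ k (hk.trans_lt hlt),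
          hq μ k (hk.trans_lt hlt), sub_self]
    exact lt_irrefl _ ((lt_rootMultiplicity_iff_isRoot_iterate_derivative h0).2 hroot)
  have hdvd : B.charpoly ∣ p - q :=
    (IsAlgClosed.splits B.charpoly).dvd_of_roots_le_roots B.charpoly_monic.ne_zero
      (Multiset.le_iff_count.2 fun μ => by simpa only [count_roots] using hmult μ)
  obtain ⟨c, hc⟩ := hdvd
  rw [hc, map_mul, aeval_self_charpoly, zero_mul]

theorem matrixFunction_eq {f : ℂ → ℂ} {B F : Matrix ι ι ℂ} (hF : IsMatrixFunction f B F) :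
    matrixFunction f B = F :=
  IsMatrixFunction.unique (Classical.epsilon_spec ⟨F, hF⟩) hF

end MatrixFunction

theorem exists_algebraMap_eval_sub_aeval_eq_mul {R : Type*} [NormedRing R] [NormedAlgebra ℂ R]
    (a : R) (p : ℂ[X]) :
    ∃ Q : ℂ → R, Differentiable ℂ Q ∧
      ∀ z, algebraMap ℂ R (p.eval z) - aeval a p = Q z * (algebraMap ℂ R z - a) := by
  induction p using Polynomial.induction_on with
  | C c => exact ⟨0, differentiable_const 0, by simp⟩
  | add p q hp hq =>
    obtain ⟨P, hP, hpP⟩ := hp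
    obtain ⟨Q, hQ, hqQ⟩ := hq
    refine ⟨P + Q, hP.add hQ, fun z => ?_⟩
    rw [Pi.add_apply, add_mul, ← hpP, ← hqQ, eval_add, map_add, map_add]
    abel
  | monomial n c ih =>
    obtain ⟨Q, hQ, hqQ⟩ := ih
    refine ⟨fun z => z • Q z + aeval a (C c * X ^ n),
      (differentiable_id.smul hQ).add_const _, fun z => ?_⟩
    rw [pow_succ, ← mul_assoc, add_mul, smul_mul_assoc, ← hqQ, map_mul _ _ X, eval_mul, eval_X,
      aeval_X, mul_sub, ← Algebra.commutes z (aeval a _), smul_sub, Algebra.smul_def,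
      Algebra.smul_def, mul_comm _ z, map_mul]
    abel

theorem exists_sub_matrixFunction_eq_mul {ι : Type*} [Fintype ι] [DecidableEq ι] {U : Set ℂ}
    (hU : IsOpen U) {f : ℂ → ℂ} (hf : DifferentiableOn ℂ f U) {B : Matrix ι ι ℂ}
    (hB : spectrum ℂ B ⊆ U) :
    ∃ H : ℂ → Matrix ι ι ℂ, DifferentiableOn ℂ H U ∧
      ∀ z ∈ U, algebraMap ℂ _ (f z) - matrixFunction f B = H z * (algebraMap ℂ _ z - B) := by
  obtain ⟨p, g, hg, hfg, hp⟩ := exists_isMatrixFunction hU hf (B := B) fun a ha =>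
    hB (Matrix.mem_spectrum_iff_isRoot_charpoly.2 ha)
  obtain ⟨P, hP, hpP⟩ := exists_algebraMap_eval_sub_aeval_eq_mul B p
  obtain ⟨Q, hQ, hqQ⟩ := exists_algebraMap_eval_sub_aeval_eq_mul B B.charpoly
  refine ⟨fun z => P z + g z • Q z, hP.differentiableOn.add (hg.smul hQ.differentiableOn),
    fun z hz => ?_⟩
  rw [add_mul, ← hpP, smul_mul_assoc, ← hqQ, aeval_self_charpoly, sub_zero, hfg z hz,
    matrixFunction_eq hp, map_add, map_mul, Algebra.smul_def]
  abel

end Interpolation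

/-- A majorant for contour integrals through a singularity at the origin: the contours are made of
horizontal and vertical lines, on which `‖z‖ ≥ |Re z|` and `‖z‖ ≥ |Im z|`. -/
structure IsContourMajorant (φ : ℝ → ℝ) : Prop where
  antitoneOn : AntitoneOn φ (Ioi 0)
  integrableOn : IntegrableOn φ (Ioi 0)
  tendsto_zero : Tendsto φ atTop (𝓝 0)

theorem IsContourMajorant.integrable_comp_abs {φ : ℝ → ℝ} (hφ : IsContourMajorant φ) :
    Integrable fun t : ℝ => φ |t| := by
  have hpos : IntegrableOn (fun t : ℝ => φ |t|) (Ioi 0) :=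
    hφ.integrableOn.congr_fun (fun t ht => by rw [abs_of_pos ht]) measurableSet_Ioi
  have hneg : IntegrableOn (fun t : ℝ => φ |t|) (Iic 0) := by
    have hcomp := ((Measure.measurePreserving_neg (volume : Measure ℝ)).integrableOn_comp_preimage
      (Homeomorph.neg ℝ).measurableEmbedding).2 hpos
    rw [integrableOn_Iic_iff_integrableOn_Iio]
    simpa [Function.comp_def] using hcomp
  rw [← integrableOn_univ, ← Iic_union_Ioi (a := (0 : ℝ))]
  exact hneg.union hpos

section CauchyTheorem

variable {E : Type*} [NormedAddCommGroup E] [NormedSpace ℂ E] {φ : ℝ → ℝ} {f g : ℂ → E}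
  {S : Set ℂ} {a b : ℝ}

/-- The assumptions of Cauchy's theorem for contours in `S` that may pass through a singularity at
the origin: `f` is holomorphic in the interior of `S`, continuous up to the boundary except at `0`,
and bounded by `φ ‖z‖`. -/
structure IsMajorized (φ : ℝ → ℝ) (f : ℂ → E) (S : Set ℂ) : Prop where
  continuousOn : ContinuousOn f (S \ {0})
  differentiableOn : DifferentiableOn ℂ f (interior S)
  norm_le : ∀ z ∈ S, z ≠ 0 → ‖f z‖ ≤ φ ‖z‖

theorem IsMajorized.mono (hf : IsMajorized φ f S) {T : Set ℂ} (hTS : T ⊆ S) :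
    IsMajorized φ f T :=
  ⟨hf.continuousOn.mono (sdiff_subset_sdiff_left hTS), hf.differentiableOn.mono (interior_mono hTS),
    fun z hz => hf.norm_le z (hTS hz)⟩

theorem IsMajorized.comp_neg (hf : IsMajorized φ f S) :
    IsMajorized φ (fun z => f (-z)) (Neg.neg ⁻¹' S) where
  continuousOn := hf.continuousOn.comp continuousOn_neg fun z hz =>
    ⟨hz.1, fun h => hz.2 (neg_eq_zero.1 h)⟩
  differentiableOn := hf.differentiableOn.comp (differentiableOn_neg _) fun z hz => by
    have hpre := (Homeomorph.neg ℂ).preimage_interior S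
    rw [Homeomorph.coe_neg] at hpre
    rwa [← hpre] at hz
  norm_le z hz hz0 := norm_neg z ▸ hf.norm_le (-z) hz (neg_ne_zero.2 hz0)

theorem IsMajorized.norm_comp_le (hφ : IsContourMajorant φ) (hf : IsMajorized φ f S) {z : ℂ}
    {t : ℝ} (ht : t ≠ 0) (htz : |t| ≤ ‖z‖) (hz : z ∈ S) : ‖f z‖ ≤ φ |t| := by
  have hpos : 0 < ‖z‖ := (abs_pos.2 ht).trans_le htz
  exact (hf.norm_le z hz (norm_pos_iff.1 hpos)).trans (hφ.antitoneOn (abs_pos.2 ht) hpos htz)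

theorem IsMajorized.integrableOn_comp (hφ : IsContourMajorant φ) (hf : IsMajorized φ f S)
    {w : ℝ → ℂ} (hw : Continuous w) (hwt : ∀ t, |t| ≤ ‖w t‖) {T : Set ℝ} (hT : MeasurableSet T)
    (hwS : ∀ t ∈ T, w t ∈ S) : IntegrableOn (fun t => f (w t)) T := by
  have hdiff : IntegrableOn (fun t => f (w t)) (T \ {0}) := by
    have hmeas : MeasurableSet (T \ {(0 : ℝ)}) := hT.diff (measurableSet_singleton 0)
    refine hφ.integrable_comp_abs.integrableOn.mono' (ContinuousOn.aestronglyMeasurable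
      (hf.continuousOn.comp hw.continuousOn fun t ht => ⟨hwS t ht.1, fun h => ?_⟩) hmeas) ?_
    · have := hwt t
      rw [h, norm_zero] at this
      exact ht.2 (abs_nonpos_iff.1 this)
    · filter_upwards [ae_restrict_mem hmeas] with t ht
      exact hf.norm_comp_le hφ ht.2 (hwt t) (hwS t ht.1)
  exact hdiff.congr_set_ae (sdiff_null_ae_eq_self (measure_singleton 0)).symm

theorem abs_le_norm_add_mul_I (t c : ℝ) : |t| ≤ ‖(t : ℂ) + c * I‖ := by
  simpa using abs_re_le_norm ((t : ℂ) + c * I)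

theorem abs_le_norm_add_mul_I' (c t : ℝ) : |t| ≤ ‖(c : ℂ) + t * I‖ := by
  simpa using abs_im_le_norm ((c : ℂ) + t * I)

theorem add_mul_I_mem_reProdIm {s t : Set ℝ} {x y : ℝ} :
    (x : ℂ) + y * I ∈ s ×ℂ t ↔ x ∈ s ∧ y ∈ t := by
  simp [mem_reProdIm]

theorem IsMajorized.integral_boundary_rect_eq_zero {c d : ℝ} (hab : a ≤ b) (hcd : c ≤ d)
    (hc : 0 < c) (hf : IsMajorized φ f (Icc a b ×ℂ Icc c d)) :
    (∫ t in a..b, f (t + c * I)) - (∫ t in a..b, f (t + d * I)) +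
      I • (∫ y in c..d, f (b + y * I)) - I • (∫ y in c..d, f (a + y * I)) = 0 := by
  have hsub : Icc a b ×ℂ Icc c d ⊆ (Icc a b ×ℂ Icc c d) \ {0} := fun z hz =>
    ⟨hz, fun h => by
      rw [mem_singleton_iff.1 h] at hz
      exact absurd hz.2.1 (not_le.2 hc)⟩
  have hrect := integral_boundary_rect_eq_zero_of_continuousOn_of_differentiableOn f
    (⟨a, c⟩ : ℂ) (⟨b, d⟩ : ℂ) (by
      simpa only [uIcc_of_le hab, uIcc_of_le hcd] using hf.continuousOn.mono hsub) (by
      simpa only [min_eq_left hab, min_eq_left hcd, max_eq_right hab, max_eq_right hcd,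
        interior_reProdIm, interior_Icc] using hf.differentiableOn)
  simpa only using hrect

theorem tendsto_intervalIntegral_inv {F : ℝ → E} (hF : IntegrableOn F (Ioi 0)) :
    Tendsto (fun δ : ℝ => ∫ y in δ..δ⁻¹, F y) (𝓝[>] 0) (𝓝 (∫ y in Ioi 0, F y)) := by
  have hcover : AECover (volume.restrict (Ioi (0 : ℝ))) (𝓝[>] (0 : ℝ)) fun δ => Ioc δ δ⁻¹ :=
    (aecover_Ioi_of_Ioi (tendsto_id.mono_left nhdsWithin_le_nhds)).inter
      ((aecover_Iic tendsto_inv_nhdsGT_zero).mono Measure.restrict_le_self)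
  refine (hcover.integral_tendsto_of_countably_generated hF).congr' ?_
  filter_upwards [Ioo_mem_nhdsGT one_pos] with δ hδ
  rw [intervalIntegral.integral_of_le (hδ.2.le.trans ((one_le_inv₀ hδ.1).2 hδ.2.le)),
    Measure.restrict_restrict measurableSet_Ioc,
    inter_eq_left.2 (Ioc_subset_Ioi_self.trans (Ioi_subset_Ioi hδ.1.le))]

theorem IsMajorized.tendsto_integral_add_mul_I (hφ : IsContourMajorant φ) (hab : a ≤ b)
    (hf : IsMajorized φ f (Icc a b ×ℂ Ici 0)) :
    Tendsto (fun δ : ℝ => ∫ t in a..b, f (t + δ * I)) (𝓝[>] 0) (𝓝 (∫ t in a..b, f t)) := by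
  have hmem : ∀ t ∈ uIoc a b, ∀ δ : ℝ, 0 ≤ δ → (t : ℂ) + δ * I ∈ Icc a b ×ℂ Ici 0 :=
    fun t ht δ hδ => add_mul_I_mem_reProdIm.2 ⟨Ioc_subset_Icc_self (uIoc_of_le hab ▸ ht), hδ⟩
  refine intervalIntegral.tendsto_integral_filter_of_dominated_convergence (fun t => φ |t|) ?_ ?_
    hφ.integrable_comp_abs.intervalIntegrable ?_
  · filter_upwards [self_mem_nhdsWithin] with δ hδ
    exact (hf.integrableOn_comp hφ (by fun_prop) (abs_le_norm_add_mul_I · δ) measurableSet_uIoc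
      fun t ht => hmem t ht δ (le_of_lt hδ)).aestronglyMeasurable
  · filter_upwards [self_mem_nhdsWithin] with δ hδ
    filter_upwards [Measure.ae_ne volume 0] with t ht htab
    exact hf.norm_comp_le hφ ht (abs_le_norm_add_mul_I t δ) (hmem t htab δ (le_of_lt hδ))
  · filter_upwards [Measure.ae_ne volume 0] with t ht htab
    have hne : ∀ δ : ℝ, (t : ℂ) + δ * I ≠ 0 := fun δ =>
      norm_pos_iff.1 ((abs_pos.2 ht).trans_le (abs_le_norm_add_mul_I t δ))
    have ht0 : (t : ℂ) + (0 : ℝ) * I = t := by simp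
    have hcont := hf.continuousOn _ ⟨hmem t htab 0 le_rfl, hne 0⟩
    rw [ContinuousWithinAt, ht0] at hcont
    refine hcont.comp (tendsto_nhdsWithin_iff.2 ⟨?_, ?_⟩)
    · refine Tendsto.mono_left ?_ nhdsWithin_le_nhds
      exact (by fun_prop : Continuous fun δ : ℝ => (t : ℂ) + δ * I).tendsto' 0 _ ht0
    · filter_upwards [self_mem_nhdsWithin] with δ hδ
      exact ⟨hmem t htab δ (le_of_lt hδ), hne δ⟩

theorem IsMajorized.tendsto_integral_add_inv_mul_I (hφ : IsContourMajorant φ) (hab : a ≤ b)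
    (hf : IsMajorized φ f (Icc a b ×ℂ Ici 0)) :
    Tendsto (fun δ : ℝ => ∫ t in a..b, f (t + (δ⁻¹ : ℝ) * I)) (𝓝[>] 0) (𝓝 0) := by
  have hbound : Tendsto (fun δ : ℝ => φ |δ⁻¹| * |b - a|) (𝓝[>] 0) (𝓝 0) := by
    simpa using ((hφ.tendsto_zero.comp tendsto_abs_atTop_atTop).comp
      tendsto_inv_nhdsGT_zero).mul_const |b - a|
  refine squeeze_zero_norm' ?_ hbound
  filter_upwards [self_mem_nhdsWithin] with δ hδ
  have hδ' : 0 < δ⁻¹ := inv_pos.2 hδ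
  refine intervalIntegral.norm_integral_le_of_norm_le_const fun t ht => ?_
  exact hf.norm_comp_le hφ hδ'.ne' (abs_le_norm_add_mul_I' t δ⁻¹)
    (add_mul_I_mem_reProdIm.2 ⟨Ioc_subset_Icc_self (uIoc_of_le hab ▸ ht), hδ'.le⟩)

theorem IsMajorized.integral_boundary_upper_half_strip (hφ : IsContourMajorant φ) (hab : a ≤ b)
    (hf : IsMajorized φ f (Icc a b ×ℂ Ici 0)) :
    (∫ t in a..b, f t) + I • (∫ y in Ioi (0 : ℝ), f (b + y * I)) -
      I • (∫ y in Ioi (0 : ℝ), f (a + y * I)) = 0 := by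
  have hvert : ∀ c ∈ Icc a b, Tendsto (fun δ : ℝ => ∫ y in δ..δ⁻¹, f (c + y * I)) (𝓝[>] 0)
      (𝓝 (∫ y in Ioi (0 : ℝ), f (c + y * I))) := fun c hc =>
    tendsto_intervalIntegral_inv (hf.integrableOn_comp hφ (by fun_prop) (abs_le_norm_add_mul_I' c)
      measurableSet_Ioi fun y hy => add_mul_I_mem_reProdIm.2 ⟨hc, Ioi_subset_Ici_self hy⟩)
  have hlim := (((hf.tendsto_integral_add_mul_I hφ hab).sub
    (hf.tendsto_integral_add_inv_mul_I hφ hab)).add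
      ((hvert b (right_mem_Icc.2 hab)).const_smul I)).sub
        ((hvert a (left_mem_Icc.2 hab)).const_smul I)
  rw [sub_zero] at hlim
  refine tendsto_nhds_unique (hlim.congr' ?_) tendsto_const_nhds
  filter_upwards [Ioo_mem_nhdsGT one_pos] with δ hδ
  refine IsMajorized.integral_boundary_rect_eq_zero hab
    (hδ.2.le.trans ((one_le_inv₀ hδ.1).2 hδ.2.le)) hδ.1 (hf.mono ?_)
  exact reProdIm_subset_iff.2 (prod_mono subset_rfl fun y hy => hδ.1.le.trans hy.1)

theorem IsMajorized.integral_boundary_lower_half_strip (hφ : IsContourMajorant φ) (hab : a ≤ b)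
    (hf : IsMajorized φ f (Icc a b ×ℂ Iic 0)) :
    I • (∫ y in Iio (0 : ℝ), f (b + y * I)) - I • (∫ y in Iio (0 : ℝ), f (a + y * I)) =
      ∫ t in a..b, f t := by
  have hupper := (hf.comp_neg.mono (T := Icc (-b) (-a) ×ℂ Ici 0) fun z hz => by
    simpa [mem_reProdIm, neg_le, le_neg, and_comm] using hz).integral_boundary_upper_half_strip
      hφ (neg_le_neg hab)
  have hvert : ∀ c : ℝ, ∫ y in Ioi (0 : ℝ), f (-((-c : ℝ) + y * I)) =
      ∫ y in Iio (0 : ℝ), f (c + y * I) := fun c => by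
    rw [← integral_Iic_eq_integral_Iio, ← neg_zero, ← integral_comp_neg_Ioi, neg_zero]
    refine integral_congr_ae (ae_of_all _ fun y => ?_)
    simp [add_comm]
  have hhoriz : ∫ t in -b..-a, f (-(t : ℂ)) = ∫ t in a..b, f t := by
    simpa using intervalIntegral.integral_comp_neg (a := -b) (b := -a) fun t : ℝ => f t
  rw [hvert, hvert, hhoriz] at hupper
  rw [← sub_eq_zero, ← neg_eq_zero, ← hupper]
  abel

theorem integral_vertical_sub_integral_vertical (hφ : IsContourMajorant φ) (hab : a ≤ b)
    (hf : IsMajorized φ f (Icc a b ×ℂ Ici 0)) (hg : IsMajorized φ g (Icc a b ×ℂ Iic 0))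
    (hfg : ∀ z : ℂ, z.im < 0 → f z = g z) :
    I • ((∫ y : ℝ, f (b + y * I)) - ∫ y : ℝ, f (a + y * I)) =
      (∫ t in a..b, g t) - ∫ t in a..b, f t := by
  have hvert : ∀ c ∈ Icc a b, ∫ y : ℝ, f (c + y * I) =
      (∫ y in Iio (0 : ℝ), g (c + y * I)) + ∫ y in Ioi (0 : ℝ), f (c + y * I) := fun c hc => by
    have heq : EqOn (fun y : ℝ => g (c + y * I)) (fun y : ℝ => f (c + y * I)) (Iio 0) :=
      fun y hy => (hfg _ (by simpa using hy)).symm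
    have hlower : IntegrableOn (fun y : ℝ => g (c + y * I)) (Iio 0) :=
      hg.integrableOn_comp hφ (by fun_prop) (abs_le_norm_add_mul_I' c) measurableSet_Iio
        fun y hy => add_mul_I_mem_reProdIm.2 ⟨hc, Iio_subset_Iic_self hy⟩
    have hupper : IntegrableOn (fun y : ℝ => f (c + y * I)) (Ioi 0) :=
      hf.integrableOn_comp hφ (by fun_prop) (abs_le_norm_add_mul_I' c) measurableSet_Ioi
        fun y hy => add_mul_I_mem_reProdIm.2 ⟨hc, Ioi_subset_Ici_self hy⟩
    rw [setIntegral_congr_fun measurableSet_Iio heq, ← integral_Iic_eq_integral_Iio,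
      intervalIntegral.integral_Iic_add_Ioi (integrableOn_Iic_iff_integrableOn_Iio (by simp) |>.2
        (hlower.congr_fun heq measurableSet_Iio)) hupper]
  have hupper := hf.integral_boundary_upper_half_strip hφ hab
  have hlower := hg.integral_boundary_lower_half_strip hφ hab
  rw [hvert b (right_mem_Icc.2 hab), hvert a (left_mem_Icc.2 hab), ← hlower,
    ← add_zero (_ - ∫ t in a..b, f t), ← hupper]
  simp only [smul_sub, smul_add]
  abel

theorem IsMajorized.integral_imaginary_axis_eq_zero (hφ : IsContourMajorant φ)
    (hf : IsMajorized φ f {z | 0 ≤ z.re}) : ∫ y : ℝ, f (y * I) = 0 := by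
  have hconst : ∀ b : ℝ, 0 ≤ b → ∫ y : ℝ, f (b + y * I) = ∫ y : ℝ, f (y * I) := fun b hb => by
    have hstrip := integral_vertical_sub_integral_vertical hφ hb (hf.mono fun z hz => hz.1.1)
      (hf.mono fun z hz => hz.1.1) fun z _ => rfl
    rw [sub_self] at hstrip
    simpa using sub_eq_zero.1 ((smul_eq_zero_iff_right I_ne_zero).1 hstrip)
  have hlim : Tendsto (fun b : ℝ => ∫ y : ℝ, f (b + y * I)) atTop (𝓝 (∫ _ : ℝ, (0 : E))) := by
    have hmem : ∀ᶠ b : ℝ in atTop, ∀ y : ℝ, (b : ℂ) + y * I ∈ {z : ℂ | 0 ≤ z.re} := by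
      filter_upwards [eventually_ge_atTop 0] with b hb y
      simpa using hb
    refine tendsto_integral_filter_of_dominated_convergence (fun y => φ |y|) ?_ ?_
      hφ.integrable_comp_abs ?_
    · filter_upwards [hmem] with b hb
      exact (integrableOn_univ.1 (hf.integrableOn_comp hφ (by fun_prop) (abs_le_norm_add_mul_I' b)
        MeasurableSet.univ fun y _ => hb y)).aestronglyMeasurable
    · filter_upwards [hmem] with b hb
      filter_upwards [Measure.ae_ne volume 0] with y hy
      exact hf.norm_comp_le hφ hy (abs_le_norm_add_mul_I' b y) (hb y)
    · refine ae_of_all _ fun y => squeeze_zero_norm' ?_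
        (hφ.tendsto_zero.comp tendsto_abs_atTop_atTop)
      filter_upwards [hmem, eventually_ne_atTop 0] with b hb hb0
      exact hf.norm_comp_le hφ hb0 (abs_le_norm_add_mul_I b y) (hb y)
  rw [integral_zero] at hlim
  refine tendsto_nhds_unique (tendsto_const_nhds.congr' ?_) hlim
  filter_upwards [eventually_ge_atTop 0] with b hb
  exact (hconst b hb).symm

end CauchyTheorem

/-- The majorant for functions that are `O(|z|^{-1/2})` at the origin and `O(|z|^{-3/2})` at
infinity. -/
def rootDecay (t : ℝ) : ℝ := (√t)⁻¹ * (1 + t)⁻¹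

theorem isContourMajorant_const_mul_rootDecay {C : ℝ} (hC : 0 ≤ C) :
    IsContourMajorant fun t => C * rootDecay t where
  antitoneOn s hs t _ hst := by
    have hs' : 0 < √s := Real.sqrt_pos.2 hs
    have hs1 : 0 < 1 + s := add_pos one_pos hs
    have ht0 : 0 < t := hs.trans_le hst
    change C * ((√t)⁻¹ * (1 + t)⁻¹) ≤ C * ((√s)⁻¹ * (1 + s)⁻¹)
    gcongr
  integrableOn := by
    refine Integrable.const_mul ?_ C
    refine integrableOn_Ioi_deriv_of_nonneg (g := fun t => 2 * Real.arctan √t)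
      (l := 2 * (Real.pi / 2)) ?_ (fun t ht => ?_) (fun t ht => ?_) ?_
    · exact ((Real.continuous_arctan.comp Real.continuous_sqrt).const_mul 2).continuousWithinAt
    · have ht0 : √t ≠ 0 := (Real.sqrt_pos.2 ht).ne'
      refine (((Real.hasDerivAt_arctan √t).comp t
        (Real.hasDerivAt_sqrt (ne_of_gt ht))).const_mul 2).congr_deriv ?_
      rw [Real.sq_sqrt (le_of_lt ht), rootDecay]
      field_simp
    · have ht0 : 0 < t := ht
      unfold rootDecay
      positivity
    · exact ((tendsto_nhds_of_tendsto_nhdsWithin Real.tendsto_arctan_atTop).comp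
        Real.tendsto_sqrt_atTop).const_mul 2
  tendsto_zero := by
    have hsqrt : Tendsto (fun t : ℝ => (√t)⁻¹) atTop (𝓝 0) :=
      tendsto_inv_atTop_zero.comp Real.tendsto_sqrt_atTop
    have hinv : Tendsto (fun t : ℝ => (1 + t)⁻¹) atTop (𝓝 0) :=
      tendsto_inv_atTop_zero.comp (tendsto_atTop_add_const_left _ _ tendsto_id)
    simpa [rootDecay] using (hsqrt.mul hinv).const_mul C

theorem exists_isMajorized_rootDecay {E : Type*} [NormedAddCommGroup E] [NormedSpace ℂ E]
    {f : ℂ → E} {S : Set ℂ} (hS : IsClosed S) (hcont : ContinuousOn f (S \ {0}))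
    (hdiff : DifferentiableOn ℂ f (interior S))
    (hzero : f =O[𝓝[S \ {0}] 0] fun z => (√‖z‖)⁻¹)
    (hinf : f =O[cobounded ℂ ⊓ 𝓟 S] fun z => (√‖z‖)⁻¹ * ‖z‖⁻¹) :
    ∃ φ, IsContourMajorant φ ∧ IsMajorized φ f S := by
  have hpos : ∀ t, 0 < t → 0 < rootDecay t := fun t ht => by
    unfold rootDecay
    positivity
  have hφ : ContinuousOn rootDecay (Ioi 0) :=
    (Real.continuous_sqrt.continuousOn.inv₀ fun t ht => (Real.sqrt_pos.2 ht).ne').mul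
      (ContinuousOn.inv₀ (by fun_prop) fun t ht => (add_pos one_pos ht).ne')
  have hzero' : (fun z : ℂ => (√‖z‖)⁻¹) =O[𝓝[S \ {0}] 0] fun z => rootDecay ‖z‖ := by
    refine Asymptotics.IsBigO.of_bound 2 ?_
    filter_upwards [nhdsWithin_le_nhds (Metric.ball_mem_nhds (0 : ℂ) one_pos)] with z hz
    have hz1 : ‖z‖ < 1 := by simpa using hz
    have hinv : 1 ≤ 2 * (1 + ‖z‖)⁻¹ := by
      rw [← div_eq_mul_inv, one_le_div (by positivity)]
      linarith
    rw [rootDecay, Real.norm_of_nonneg (by positivity), Real.norm_of_nonneg (by positivity),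
      mul_left_comm]
    exact le_mul_of_one_le_right (by positivity) hinv
  have hinf' : (fun z : ℂ => (√‖z‖)⁻¹ * ‖z‖⁻¹) =O[cobounded ℂ ⊓ 𝓟 S] fun z => rootDecay ‖z‖ := by
    refine Asymptotics.IsBigO.of_bound 2 (mem_inf_of_left ?_)
    filter_upwards [tendsto_norm_cobounded_atTop.eventually_ge_atTop 1] with z hz
    have hinv : ‖z‖⁻¹ ≤ 2 * (1 + ‖z‖)⁻¹ := by
      rw [← div_eq_mul_inv, ← one_div, div_le_div_iff₀ (by positivity) (by positivity)]
      linarith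
    rw [rootDecay, Real.norm_of_nonneg (by positivity), Real.norm_of_nonneg (by positivity),
      mul_left_comm]
    exact mul_le_mul_of_nonneg_left hinv (by positivity)
  obtain ⟨C, hC, hle⟩ :=
    exists_norm_le_mul_of_isBigO hS hcont hφ hpos (hzero.trans hzero') (hinf.trans hinf')
  exact ⟨_, isContourMajorant_const_mul_rootDecay hC.le, hcont, hdiff, hle⟩

theorem one_isBigO_inv_sqrt_norm (S : Set ℂ) :
    (fun _ => (1 : ℝ)) =O[𝓝[S \ {0}] 0] fun z => (√‖z‖)⁻¹ := by
  refine Asymptotics.IsBigO.of_bound 1 ?_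
  filter_upwards [self_mem_nhdsWithin,
    nhdsWithin_le_nhds (Metric.ball_mem_nhds (0 : ℂ) one_pos)] with z hz hz1
  have hpos : 0 < √‖z‖ := Real.sqrt_pos.2 (norm_pos_iff.2 hz.2)
  rw [one_mul, norm_one, Real.norm_of_nonneg (by positivity), one_le_inv₀ hpos]
  exact Real.sqrt_le_one.2 (mem_ball_zero_iff.1 hz1).le

section Resolvent

variable {R : Type*} [NormedRing R] [NormedAlgebra ℂ R]

theorem resolvent_algebraMap {c z : ℂ} (hz : z ≠ c) :
    resolvent (algebraMap ℂ R c) z = (z - c)⁻¹ • (1 : R) := by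
  have hzc : z - c ≠ 0 := sub_ne_zero.2 hz
  rw [resolvent, ← map_sub, ← Algebra.algebraMap_eq_smul_one]
  have hunit : IsUnit (algebraMap ℂ R (z - c)) := (isUnit_iff_ne_zero.2 hzc).map _
  refine hunit.mul_left_cancel ?_
  rw [Ring.mul_inverse_cancel _ hunit, ← map_mul, mul_inv_cancel₀ hzc, map_one]

variable [CompleteSpace R]

theorem eventually_mem_resolventSet_cobounded (a : R) :
    ∀ᶠ z in cobounded ℂ, z ∈ resolventSet ℂ a := by
  filter_upwards [isBounded_def.1 (spectrum.isBounded (𝕜 := ℂ) a)] with z hz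
  exact spectrum.notMem_iff.1 hz

theorem resolvent_sub_resolvent_isBigO (a b : R) :
    (fun z : ℂ => resolvent a z - resolvent b z) =O[cobounded ℂ] fun z => (√‖z‖)⁻¹ * ‖z‖⁻¹ := by
  have hle : (fun z : ℂ => ‖z‖⁻¹ * ‖z‖⁻¹) =O[cobounded ℂ] fun z => (√‖z‖)⁻¹ * ‖z‖⁻¹ := by
    refine Asymptotics.IsBigO.of_bound 1 ?_
    filter_upwards [tendsto_norm_cobounded_atTop.eventually_ge_atTop 1] with z hz
    have hsqrt : √‖z‖ ≤ ‖z‖ := Real.sqrt_le_self_iff.2 (.inr hz)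
    have hpos : 0 < √‖z‖ := Real.sqrt_pos.2 (one_pos.trans_le hz)
    rw [one_mul, Real.norm_of_nonneg (by positivity), Real.norm_of_nonneg (by positivity)]
    gcongr
  have hprod := ((spectrum.resolvent_isBigO_inv (𝕜 := ℂ) a).norm_right.mul
    (Asymptotics.isBigO_const_const (a - b) (one_ne_zero (α := ℝ)) _)).mul
      (spectrum.resolvent_isBigO_inv (𝕜 := ℂ) b).norm_right
  refine (hprod.congr' ?_ ?_).trans hle
  · filter_upwards [eventually_mem_resolventSet_cobounded a,
      eventually_mem_resolventSet_cobounded b] with z hza hzb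
    exact (spectrum.resolvent_sub_resolvent hza hzb).symm
  · exact .of_forall fun z => by simp

theorem differentiableOn_resolvent {a : R} {S : Set ℂ} (hS : Disjoint S (spectrum ℂ a)) :
    DifferentiableOn ℂ (resolvent a) S := fun _ hz =>
  (spectrum.hasDerivAt_resolvent_const_left (spectrum.notMem_iff.1
    (hS.notMem_of_mem_left hz))).differentiableAt.differentiableWithinAt

/-- Both integrals diverge separately; the difference vanishes because its integrand is holomorphic
in the left half-plane and decays like `|z|⁻²`. -/
theorem integral_resolvent_sub_resolvent_eq_zero {a b : R} (ha : ∀ z ∈ spectrum ℂ a, 0 < z.re)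
    (hb : ∀ z ∈ spectrum ℂ b, 0 < z.re) :
    Integrable (fun y : ℝ => resolvent a (y * I) - resolvent b (y * I)) ∧
      ∫ y : ℝ, (resolvent a (y * I) - resolvent b (y * I)) = 0 := by
  have hdiff : DifferentiableOn ℂ (fun z => resolvent a z - resolvent b z) {z : ℂ | z.re ≤ 0} :=
    (differentiableOn_resolvent (disjoint_left.2 fun z hz hza => (ha z hza).not_ge hz)).sub
      (differentiableOn_resolvent (disjoint_left.2 fun z hz hzb => (hb z hzb).not_ge hz))
  have hzero : (fun z => resolvent a z - resolvent b z) =O[𝓝[{z : ℂ | z.re ≤ 0} \ {0}] 0]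
      fun z => (√‖z‖)⁻¹ :=
    (((hdiff.continuousOn 0 (by simp)).mono_left (nhdsWithin_mono _ sdiff_subset)).isBigO_one
      ℝ).trans (one_isBigO_inv_sqrt_norm _)
  obtain ⟨φ, hφ, hf⟩ := exists_isMajorized_rootDecay
    (isClosed_le continuous_re continuous_const) (hdiff.continuousOn.mono sdiff_subset)
    (hdiff.mono interior_subset) hzero ((resolvent_sub_resolvent_isBigO a b).mono inf_le_left)
  refine ⟨integrableOn_univ.1 (hf.integrableOn_comp hφ (by fun_prop) (fun y => by simp)
    MeasurableSet.univ fun y _ => by simp), ?_⟩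
  have haxis := (hf.comp_neg.mono (T := {z : ℂ | 0 ≤ z.re}) fun z hz => by
    simpa using hz).integral_imaginary_axis_eq_zero hφ
  rw [← haxis, ← integral_neg_eq_self]
  simp

theorem integral_resolvent_sub_resolvent_neg_one {a : R} (ha : ∀ z ∈ spectrum ℂ a, 0 < z.re) :
    Integrable (fun y : ℝ => resolvent a (y * I) - resolvent (algebraMap ℂ R (-1)) (y * I)) ∧
      ∫ y : ℝ, (resolvent a (y * I) - resolvent (algebraMap ℂ R (-1)) (y * I)) =
        -((2 * Real.pi : ℝ) • (1 : R)) := by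
  have hone : ∀ z ∈ spectrum ℂ (algebraMap ℂ R 1), 0 < z.re := fun z hz => by
    have : z = 1 := by
      by_contra hne
      refine spectrum.mem_iff.1 hz ?_
      rw [← map_sub]
      exact (isUnit_iff_ne_zero.2 (sub_ne_zero.2 hne)).map _
    simp [this]
  obtain ⟨hint, hzero⟩ := integral_resolvent_sub_resolvent_eq_zero ha hone
  have hscalar : ∀ y : ℝ, resolvent (algebraMap ℂ R 1) (y * I) -
      resolvent (algebraMap ℂ R (-1)) (y * I) = (-2 * (1 + y ^ 2)⁻¹ : ℝ) • (1 : R) := fun y => by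
    have hne : (y * I : ℂ) ≠ 1 := fun h => by simpa using congrArg re h
    have hne' : (y * I : ℂ) ≠ -1 := fun h => by simpa using congrArg re h
    have hsq : (1 + y ^ 2 : ℂ) ≠ 0 := by exact_mod_cast (by positivity : (1 + y ^ 2 : ℝ) ≠ 0)
    rw [resolvent_algebraMap hne, resolvent_algebraMap hne', ← sub_smul, ← Complex.coe_smul]
    congr 1
    have := sub_ne_zero.2 hne
    have := sub_ne_zero.2 hne'
    push_cast
    field_simp
    linear_combination 2 * (y : ℂ) ^ 2 * I_sq
  have hint' : Integrable fun y : ℝ => (-2 * (1 + y ^ 2)⁻¹ : ℝ) • (1 : R) :=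
    (integrable_inv_one_add_sq.const_mul (-2)).smul_const _
  have hsplit : ∀ y : ℝ, resolvent a (y * I) - resolvent (algebraMap ℂ R (-1)) (y * I) =
      (resolvent a (y * I) - resolvent (algebraMap ℂ R 1) (y * I)) +
        (-2 * (1 + y ^ 2)⁻¹ : ℝ) • (1 : R) := fun y => by
    rw [← hscalar, sub_add_sub_cancel]
  simp only [hsplit]
  refine ⟨hint.add hint', ?_⟩
  rw [integral_add hint hint', hzero, zero_add, integral_smul_const, integral_const_mul,
    integral_univ_inv_one_add_sq, neg_mul, neg_smul]

theorem smul_resolvent_sub_mul_isBigO_zero {a : R} {f : ℂ → ℂ} {S : Set ℂ}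
    (ha : (0 : ℂ) ∈ resolventSet ℂ a) (hf : f =O[𝓝[S \ {0}] 0] fun z => (√‖z‖)⁻¹) (F : R) :
    (fun z => f z • resolvent a z - F * (resolvent a z - resolvent (algebraMap ℂ R (-1)) z))
      =O[𝓝[S \ {0}] 0] fun z => (√‖z‖)⁻¹ := by
  have hbdd : ∀ b : R, (0 : ℂ) ∈ resolventSet ℂ b →
      resolvent b =O[𝓝[S \ {0}] 0] fun _ => (1 : ℝ) := fun b hb =>
    ((spectrum.hasDerivAt_resolvent_const_left hb).continuousAt.mono_left
      nhdsWithin_le_nhds).isBigO_one ℝ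
  have hneg : (0 : ℂ) ∈ resolventSet ℂ (algebraMap ℂ R (-1)) := by
    simp [spectrum.mem_resolventSet_iff]
  refine .sub ((hf.smul (hbdd a ha)).congr_right fun z => mul_one _) (.trans ?_
    (one_isBigO_inv_sqrt_norm S))
  exact ((hbdd a ha).sub (hbdd _ hneg)).const_mul_left F

theorem smul_resolvent_sub_mul_isBigO_cobounded (a : R) {f : ℂ → ℂ} {l : Filter ℂ}
    (hl : l ≤ cobounded ℂ) (hf : f =O[l] fun z => (√‖z‖)⁻¹) (F : R) :
    (fun z => f z • resolvent a z - F * (resolvent a z - resolvent (algebraMap ℂ R (-1)) z))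
      =O[l] fun z => (√‖z‖)⁻¹ * ‖z‖⁻¹ := by
  refine .sub ((hf.smul ((spectrum.resolvent_isBigO_inv (𝕜 := ℂ) a).norm_right.mono
    hl)).congr_right fun z => by rw [norm_inv, smul_eq_mul]) ?_
  exact ((resolvent_sub_resolvent_isBigO a _).mono hl).const_mul_left F

/-- Adding `(z + 1)⁻¹ • F` to `H` makes it `O(|z|^{-3/2})` at infinity. -/
theorem exists_isMajorized_add_inv_smul {a F : R} {f : ℂ → ℂ} {H : ℂ → R} {c : ℝ}
    (ha : (0 : ℂ) ∈ resolventSet ℂ a) (hH : DifferentiableOn ℂ H ({z | 0 ≤ z.re} \ {0}))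
    (hHeq : ∀ z : ℂ, 0 ≤ z.re → z ≠ 0 → z ∈ resolventSet ℂ a → H z + (z + 1)⁻¹ • F =
      f z • resolvent a z - F * (resolvent a z - resolvent (algebraMap ℂ R (-1)) z))
    (hf : ∀ z : ℂ, 0 ≤ z.re → z ≠ 0 → ‖f z‖ ≤ c * (√‖z‖)⁻¹) :
    ∃ φ, IsContourMajorant φ ∧
      IsMajorized φ (fun z => H z + (z + 1)⁻¹ • F) {z : ℂ | 0 ≤ z.re} := by
  have hfO : ∀ l : Filter ℂ, {z : ℂ | 0 ≤ z.re} \ {0} ∈ l →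
      f =O[l] fun z => (√‖z‖)⁻¹ := fun l hl => Asymptotics.IsBigO.of_bound c <| by
    filter_upwards [hl] with z hz
    exact (hf z hz.1 hz.2).trans_eq (by rw [Real.norm_of_nonneg (by positivity)])
  have hnhds : {z : ℂ | 0 ≤ z.re} \ {0} ∈ 𝓝[{z : ℂ | 0 ≤ z.re} \ {0}] 0 := self_mem_nhdsWithin
  have hcobdd : {z : ℂ | 0 ≤ z.re} \ {0} ∈ cobounded ℂ ⊓ 𝓟 {z : ℂ | 0 ≤ z.re} :=
    inter_mem (mem_inf_of_right (mem_principal_self _))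
      (mem_inf_of_left (isBounded_def.1 isBounded_singleton))
  have hdiff : DifferentiableOn ℂ (fun z => H z + (z + 1)⁻¹ • F) ({z | 0 ≤ z.re} \ {0}) :=
    hH.add (DifferentiableOn.smul_const (DifferentiableOn.inv (by fun_prop) fun z hz h => by
      have : z.re = -1 := by rw [eq_neg_of_add_eq_zero_left h, neg_re, one_re]
      linarith [show 0 ≤ z.re from hz.1]) F)
  have hinterior : interior {z : ℂ | 0 ≤ z.re} ⊆ {z | 0 ≤ z.re} \ {0} := fun z hz => by
    refine ⟨interior_subset hz, fun h => ?_⟩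
    rw [interior_setOfPred_le_re, mem_singleton_iff.1 h] at hz
    exact lt_irrefl (0 : ℝ) hz
  refine exists_isMajorized_rootDecay (isClosed_le continuous_const continuous_re)
    hdiff.continuousOn (hdiff.mono hinterior) ?_ ?_
  · refine (smul_resolvent_sub_mul_isBigO_zero ha (hfO _ hnhds) F).congr' ?_ .rfl
    filter_upwards [hnhds, nhdsWithin_le_nhds ((spectrum.isOpen_resolventSet a).mem_nhds ha)]
      with z hz hza
    exact (hHeq z hz.1 hz.2 hza).symm
  · refine (smul_resolvent_sub_mul_isBigO_cobounded a inf_le_left (hfO _ hcobdd) F).congr' ?_ .rfl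
    filter_upwards [hcobdd, mem_inf_of_left (eventually_mem_resolventSet_cobounded a)] with z hz hza
    exact (hHeq z hz.1 hz.2 hza).symm

theorem integral_smul_resolvent {a F : R} {f : ℂ → ℂ} {H : ℂ → R} {U : Set ℂ} {c : ℝ}
    (ha : ∀ z ∈ spectrum ℂ a, 0 < z.re) (hU : {z : ℂ | 0 ≤ z.re} \ {0} ⊆ U)
    (hH : DifferentiableOn ℂ H U)
    (hfH : ∀ z ∈ U, algebraMap ℂ R (f z) - F = H z * (algebraMap ℂ R z - a))
    (hf : ∀ z : ℂ, 0 ≤ z.re → z ≠ 0 → ‖f z‖ ≤ c * (√‖z‖)⁻¹) :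
    Integrable (fun y : ℝ => f (y * I) • resolvent a (y * I)) ∧
      ∫ y : ℝ, f (y * I) • resolvent a (y * I) = -((2 * Real.pi : ℝ) • F) := by
  have hG : ∀ z : ℂ, 0 ≤ z.re → z ≠ 0 → z ∈ resolventSet ℂ a → H z + (z + 1)⁻¹ • F =
      f z • resolvent a z - F * (resolvent a z - resolvent (algebraMap ℂ R (-1)) z) := by
    intro z hz hz0 hza
    have hz1 : z ≠ -1 := by
      rintro rfl
      norm_num at hz
    have hHz : H z = (algebraMap ℂ R (f z) - F) * resolvent a z := by
      rw [hfH z (hU ⟨hz, hz0⟩), mul_assoc, resolvent, Ring.mul_inverse_cancel _ hza, mul_one]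
    rw [hHz, resolvent_algebraMap hz1, sub_neg_eq_add, sub_mul, mul_sub, Algebra.smul_def (f z),
      mul_smul_one]
    abel
  have hmem : ∀ y : ℝ, (y * I : ℂ) ∈ resolventSet ℂ a := fun y =>
    spectrum.notMem_iff.1 fun h => by simpa using ha _ h
  obtain ⟨φ, hφ, hmaj⟩ := exists_isMajorized_add_inv_smul
    (spectrum.notMem_iff.1 fun h => (ha 0 h).ne' rfl) (hH.mono hU) hG hf
  have hint : Integrable fun y : ℝ => H (y * I) + ((y * I : ℂ) + 1)⁻¹ • F :=
    integrableOn_univ.1 (hmaj.integrableOn_comp hφ (by fun_prop) (fun y => by simp)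
      MeasurableSet.univ fun y _ => by simp)
  obtain ⟨hintD, hD⟩ := integral_resolvent_sub_resolvent_neg_one ha
  have hae : (fun y : ℝ => f (y * I) • resolvent a (y * I)) =ᵐ[volume] fun y : ℝ =>
      (H (y * I) + ((y * I : ℂ) + 1)⁻¹ • F) +
        F * (resolvent a (y * I) - resolvent (algebraMap ℂ R (-1)) (y * I)) := by
    filter_upwards [compl_mem_ae_iff.2 (measure_singleton (0 : ℝ))] with y hy
    rw [hG _ (by simp) (by simpa using hy) (hmem y), sub_add_cancel]
  refine ⟨(hint.add (hintD.const_mul F)).congr hae.symm, ?_⟩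
  rw [integral_congr_ae hae, integral_add hint (hintD.const_mul F),
    hmaj.integral_imaginary_axis_eq_zero hφ, zero_add, integral_const_mul_of_integrable hintD, hD,
    mul_neg, mul_smul_one]

end Resolvent

/-- The kernel `e^{-dw} / (2w)` of the transfer operator as a function of the square root
`w = √(z/i)`. -/
def kernelOfSqrt (d : ℝ) (w : ℂ) : ℂ := 1 / (2 * w) * exp (-(d : ℂ) * w)

theorem transferK_eq (x : ℝ) (z : ℂ) : transferK x z = kernelOfSqrt |x| (sqrtDivI z) := rfl

/-- The branch of the kernel `K(·, x)` that is continuous up to the cut from below. -/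
def transferKBelow (x : ℝ) (z : ℂ) : ℂ := kernelOfSqrt |x| (-I * sqrtDivI (-z))

theorem differentiableAt_kernelOfSqrt (d : ℝ) {w : ℂ} (hw : w ≠ 0) :
    DifferentiableAt ℂ (kernelOfSqrt d) w := by
  have : 2 * w ≠ 0 := mul_ne_zero two_ne_zero hw
  unfold kernelOfSqrt
  fun_prop (disch := exact this)

theorem norm_kernelOfSqrt_le {d : ℝ} (hd : 0 ≤ d) {w z : ℂ} (hw : w ^ 2 = -I * z)
    (him : w.im ≤ w.re) {ξ : ℝ} (hz : -ξ ≤ z.re) :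
    ‖kernelOfSqrt d w‖ ≤ Real.exp (d * √(ξ / 2)) / 2 * (√‖z‖)⁻¹ := by
  have hnorm : ‖w‖ = √‖z‖ := by
    rw [← Real.sqrt_sq (norm_nonneg w), ← norm_pow, hw]
    simp
  have hre : -√(ξ / 2) ≤ w.re := by
    have hmul := congrArg im hw
    simp only [sq, mul_im, neg_re, I_re, neg_im, I_im] at hmul
    by_contra! hlt
    have hsq := (Real.sqrt_lt' (by linarith [Real.sqrt_nonneg (ξ / 2)])).1 (lt_neg_of_lt_neg hlt)
    nlinarith [Real.sqrt_nonneg (ξ / 2)]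
  have hexp : (-(d : ℂ) * w).re ≤ d * √(ξ / 2) := by
    rw [neg_mul, neg_re, re_ofReal_mul]
    nlinarith
  calc ‖kernelOfSqrt d w‖ = 1 / (2 * √‖z‖) * Real.exp (-(d : ℂ) * w).re := by
        rw [kernelOfSqrt, norm_mul, norm_div, norm_mul, hnorm, norm_exp, norm_one, norm_ofNat]
    _ ≤ 1 / (2 * √‖z‖) * Real.exp (d * √(ξ / 2)) := by gcongr
    _ = _ := by ring

theorem exp_neg_pi_div_four : exp (-(I * Real.pi / 4)) = (√2 / 2 : ℝ) * (1 - I) := by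
  have : -(I * Real.pi / 4) = ((-(Real.pi / 4) : ℝ) : ℂ) * I := by
    push_cast
    ring
  rw [this, exp_mul_I, ← ofReal_cos, ← ofReal_sin, Real.cos_neg, Real.sin_neg,
    Real.cos_pi_div_four, Real.sin_pi_div_four]
  push_cast
  ring

theorem sqrtDivI_sq (z : ℂ) : sqrtDivI z ^ 2 = -I * z := by
  have hsqrt : ((√2 : ℝ) : ℂ) ^ 2 = 2 := by exact_mod_cast Real.sq_sqrt zero_le_two
  have hcpow : (z ^ (1 / 2 : ℂ)) ^ 2 = z := by simp
  rw [sqrtDivI, mul_pow, exp_neg_pi_div_four, hcpow]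
  push_cast
  linear_combination z * (1 - I) ^ 2 / 4 * hsqrt + z / 2 * I_sq

theorem sqrtDivI_ne_zero {z : ℂ} (hz : z ≠ 0) : sqrtDivI z ≠ 0 := by
  have : sqrtDivI z ^ 2 ≠ 0 := by
    rw [sqrtDivI_sq]
    exact mul_ne_zero (neg_ne_zero.2 I_ne_zero) hz
  exact ne_zero_pow two_ne_zero this

theorem sqrtDivI_im_le_re (z : ℂ) : (sqrtDivI z).im ≤ (sqrtDivI z).re := by
  have hre : 0 ≤ (z ^ (1 / 2 : ℂ)).re := by
    rw [one_div, cpow_inv_two_re]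
    exact Real.sqrt_nonneg _
  have : 0 ≤ √2 * (z ^ (1 / 2 : ℂ)).re := by positivity
  rw [sqrtDivI, exp_neg_pi_div_four, mul_assoc, im_ofReal_mul, re_ofReal_mul]
  simp only [mul_im, mul_re, sub_re, sub_im, one_re, one_im, I_re, I_im]
  linarith

theorem neg_I_mul_sqrtDivI_neg_im_le_re {z : ℂ} (hz : z.im ≤ 0) :
    (-I * sqrtDivI (-z)).im ≤ (-I * sqrtDivI (-z)).re := by
  have him : 0 ≤ ((-z) ^ (1 / 2 : ℂ)).im := by
    rw [one_div, cpow_inv_two_im_eq_sqrt (by simpa using hz)]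
    exact Real.sqrt_nonneg _
  have : 0 ≤ √2 * ((-z) ^ (1 / 2 : ℂ)).im := by positivity
  rw [sqrtDivI, exp_neg_pi_div_four, mul_left_comm, mul_assoc,
    im_ofReal_mul, re_ofReal_mul]
  simp only [mul_im, mul_re, sub_re, sub_im, one_re, one_im, neg_re, neg_im, I_re, I_im]
  linarith

theorem continuousOn_sqrtDivI : ContinuousOn sqrtDivI ({z | 0 ≤ z.im} \ {0}) := by
  have hlog : ContinuousOn log ({z | 0 ≤ z.im} \ {0}) := fun z hz => by
    by_cases hslit : z ∈ slitPlane
    · exact (continuousAt_clog hslit).continuousWithinAt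
    · rw [mem_slitPlane_iff, not_or, not_lt, not_not] at hslit
      refine (continuousWithinAt_log_of_re_neg_of_im_zero ?_ hslit.2).mono sdiff_subset
      exact hslit.1.lt_of_ne fun h => hz.2 (Complex.ext h hslit.2)
  refine continuousOn_const.mul (ContinuousOn.congr (f := fun z => exp (log z * (1 / 2)))
    (by fun_prop) fun z hz => cpow_def_of_ne_zero hz.2 _)

theorem differentiableAt_sqrtDivI {z : ℂ} (hz : z ∈ slitPlane) :
    DifferentiableAt ℂ sqrtDivI z :=
  (differentiableAt_id.cpow_const hz).const_mul _

theorem exp_pi_mul_I_mul_one_half : exp (Real.pi * I * (1 / 2)) = I := by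
  rw [mul_one_div, mul_div_right_comm, exp_pi_div_two_mul_I]

theorem sqrtDivI_eq_of_im_neg {z : ℂ} (hz : z.im < 0) : sqrtDivI z = -I * sqrtDivI (-z) := by
  have hz0 : z ≠ 0 := fun h => by simp [h] at hz
  have hlog : log (-z) = log z + Real.pi * I := by
    rw [log, log, norm_neg, arg_neg_eq_arg_add_pi_of_im_neg hz]
    push_cast
    ring
  rw [sqrtDivI, sqrtDivI, cpow_def_of_ne_zero hz0, cpow_def_of_ne_zero (neg_ne_zero.2 hz0), hlog,
    add_mul, Complex.exp_add (log z * _),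
    exp_pi_mul_I_mul_one_half]
  linear_combination exp (-(I * Real.pi / 4)) * exp (log z * (1 / 2)) * I_sq

theorem sqrtDivI_ofReal {l : ℝ} (hl : 0 ≤ l) :
    sqrtDivI l = exp (-(I * Real.pi / 4)) * (√l : ℝ) := by
  rw [sqrtDivI, Real.sqrt_eq_rpow, ofReal_cpow hl]
  norm_num

theorem sqrtDivI_neg_ofReal {l : ℝ} (hl : 0 ≤ l) : sqrtDivI (-l) = I * sqrtDivI l := by
  have := ofReal_cpow_of_nonpos (neg_nonpos.2 hl) (1 / 2)
  rw [exp_pi_mul_I_mul_one_half] at this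
  push_cast at this
  rw [sqrtDivI, this, sqrtDivI, neg_neg]
  ring

theorem jumpG_eq (x : ℝ) {l : ℝ} (hl : 0 < l) :
    jumpG l x = transferKBelow x (-l) - transferK x (-l) := by
  have hsqrt : ((√l : ℝ) : ℂ) ≠ 0 := by exact_mod_cast (Real.sqrt_pos.2 hl).ne'
  have hv : sqrtDivI (-l) = exp (I * Real.pi / 4) * (√l : ℝ) := by
    have hexp : I * exp (-(I * Real.pi / 4)) = exp (I * Real.pi / 4) := by
      nth_rw 1 [← exp_pi_div_two_mul_I]
      rw [← Complex.exp_add]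
      congr 1
      ring
    rw [sqrtDivI_neg_ofReal hl.le, sqrtDivI_ofReal hl.le, ← mul_assoc, hexp]
  have hbelow : -I * sqrtDivI (- -l) = -(exp (I * Real.pi / 4) * (√l : ℝ)) := by
    rw [← hv, sqrtDivI_neg_ofReal hl.le, neg_neg, neg_mul]
  have hsq : exp (I * Real.pi / 4) ^ 2 = I := by
    have : ((2 : ℕ) : ℂ) * (I * Real.pi / 4) = Real.pi / 2 * I := by
      push_cast
      ring
    rw [← exp_nat_mul, this, exp_pi_div_two_mul_I]
  have hfactor : I * exp (I * Real.pi / 4) / ((√l : ℝ) : ℂ) =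
      -1 / (exp (I * Real.pi / 4) * (√l : ℝ)) := by
    have := exp_ne_zero (I * Real.pi / 4)
    field_simp
    linear_combination I * hsq + I_sq
  rw [transferKBelow, transferK_eq, hbelow, hv, jumpG, hfactor, kernelOfSqrt, kernelOfSqrt, cosh,
    neg_mul_neg, neg_mul, ← mul_assoc]
  have := mul_ne_zero (exp_ne_zero (I * Real.pi / 4)) hsqrt
  field_simp
  ring

theorem differentiableOn_transferK (x : ℝ) : DifferentiableOn ℂ (transferK x) slitPlane :=
  fun z hz => ((differentiableAt_kernelOfSqrt |x| (sqrtDivI_ne_zero (slitPlane_ne_zero hz))).comp z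
    (differentiableAt_sqrtDivI hz)).differentiableWithinAt

theorem norm_transferK_le (x : ℝ) {z : ℂ} {ξ : ℝ} (hz : -ξ ≤ z.re) :
    ‖transferK x z‖ ≤ Real.exp (|x| * √(ξ / 2)) / 2 * (√‖z‖)⁻¹ :=
  norm_kernelOfSqrt_le (abs_nonneg x) (sqrtDivI_sq z) (sqrtDivI_im_le_re z) hz

theorem norm_transferKBelow_le (x : ℝ) {z : ℂ} {ξ : ℝ} (hz : -ξ ≤ z.re) (him : z.im ≤ 0) :
    ‖transferKBelow x z‖ ≤ Real.exp (|x| * √(ξ / 2)) / 2 * (√‖z‖)⁻¹ :=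
  norm_kernelOfSqrt_le (abs_nonneg x) (by rw [mul_pow, neg_sq, I_sq, sqrtDivI_sq]; ring)
    (neg_I_mul_sqrtDivI_neg_im_le_re him) hz

theorem transferK_eq_transferKBelow (x : ℝ) {z : ℂ} (hz : z.im < 0) :
    transferK x z = transferKBelow x z := by
  rw [transferK_eq, sqrtDivI_eq_of_im_neg hz, transferKBelow]

theorem continuousOn_transferK (x : ℝ) : ContinuousOn (transferK x) ({z | 0 ≤ z.im} \ {0}) :=
  fun z hz => (differentiableAt_kernelOfSqrt |x| (sqrtDivI_ne_zero
    hz.2)).continuousAt.comp_continuousWithinAt (continuousOn_sqrtDivI z hz)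

theorem continuousOn_transferKBelow (x : ℝ) :
    ContinuousOn (transferKBelow x) ({z | z.im ≤ 0} \ {0}) := fun z hz => by
  have hsqrt : ContinuousWithinAt (fun z => sqrtDivI (-z)) ({z | z.im ≤ 0} \ {0}) z :=
    continuousOn_sqrtDivI.comp continuousOn_neg (fun w hw => by simpa using hw) z hz
  exact ContinuousAt.comp_continuousWithinAt (f := fun z => -I * sqrtDivI (-z))
    (differentiableAt_kernelOfSqrt |x| (mul_ne_zero (neg_ne_zero.2 I_ne_zero)
      (sqrtDivI_ne_zero (neg_ne_zero.2 hz.2)))).continuousAt (hsqrt.const_mul (-I))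

section Contour

variable {E : Type*} [NormedAddCommGroup E] [NormedSpace ℂ E] {W : ℂ → E} {C ξ : ℝ}

/-- The majorant of `transferK x z • W z` in the strip `-ξ ≤ re z ≤ 0` when `‖W z‖` is at most
`C * (1 + ‖z‖)⁻¹`. -/
def transferMajorant (x ξ C : ℝ) (t : ℝ) : ℝ :=
  Real.exp (|x| * √(ξ / 2)) / 2 * C * rootDecay t

theorem isContourMajorant_transferMajorant (x ξ : ℝ) (hC : 0 ≤ C) :
    IsContourMajorant (transferMajorant x ξ C) :=
  isContourMajorant_const_mul_rootDecay (by positivity)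

theorem norm_smul_le_transferMajorant {x : ℝ} {k z : ℂ} {w : E}
    (hk : ‖k‖ ≤ Real.exp (|x| * √(ξ / 2)) / 2 * (√‖z‖)⁻¹) (hw : ‖w‖ ≤ C * (1 + ‖z‖)⁻¹) :
    ‖k • w‖ ≤ transferMajorant x ξ C ‖z‖ := by
  rw [norm_smul, transferMajorant, rootDecay, mul_mul_mul_comm]
  exact mul_le_mul hk hw (norm_nonneg _) (by positivity)

theorem isMajorized_transferK_smul (x ξ : ℝ) (hW : ∀ z : ℂ, z.re ≤ 0 → DifferentiableAt ℂ W z)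
    (hWle : ∀ z : ℂ, z.re ≤ 0 → z ≠ 0 → ‖W z‖ ≤ C * (1 + ‖z‖)⁻¹) :
    IsMajorized (transferMajorant x ξ C) (fun z => transferK x z • W z)
      (Icc (-ξ) 0 ×ℂ Ici 0) where
  continuousOn := ((continuousOn_transferK x).mono fun z hz => ⟨hz.1.2, hz.2⟩).smul fun z hz =>
    (hW z hz.1.1.2).continuousAt.continuousWithinAt
  differentiableOn := by
    rw [interior_reProdIm, interior_Icc, interior_Ici]
    exact ((differentiableOn_transferK x).mono fun z hz => .inr hz.2.ne').smul fun z hz =>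
      (hW z hz.1.2.le).differentiableWithinAt
  norm_le z hz hz0 := norm_smul_le_transferMajorant (norm_transferK_le x hz.1.1)
    (hWle z hz.1.2 hz0)

theorem isMajorized_transferKBelow_smul (x ξ : ℝ)
    (hW : ∀ z : ℂ, z.re ≤ 0 → DifferentiableAt ℂ W z)
    (hWle : ∀ z : ℂ, z.re ≤ 0 → z ≠ 0 → ‖W z‖ ≤ C * (1 + ‖z‖)⁻¹) :
    IsMajorized (transferMajorant x ξ C) (fun z => transferKBelow x z • W z)
      (Icc (-ξ) 0 ×ℂ Iic 0) where
  continuousOn := ((continuousOn_transferKBelow x).mono fun z hz => ⟨hz.1.2, hz.2⟩).smul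
    fun z hz => (hW z hz.1.1.2).continuousAt.continuousWithinAt
  differentiableOn := by
    rw [interior_reProdIm, interior_Icc, interior_Iic]
    refine (((differentiableOn_transferK x).mono fun z hz => .inr hz.2.ne).congr fun z hz =>
      (transferK_eq_transferKBelow x hz.2).symm).smul fun z hz =>
      (hW z hz.1.2.le).differentiableWithinAt
  norm_le z hz hz0 := norm_smul_le_transferMajorant (norm_transferKBelow_le x hz.1.1 hz.2)
    (hWle z hz.1.2 hz0)

theorem integrable_transferK_smul (x : ℝ) (hC : 0 ≤ C)
    (hW : ∀ z : ℂ, z.re ≤ 0 → DifferentiableAt ℂ W z)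
    (hWle : ∀ z : ℂ, z.re ≤ 0 → z ≠ 0 → ‖W z‖ ≤ C * (1 + ‖z‖)⁻¹) {c : ℝ} (hc : c ≤ 0) :
    Integrable fun y : ℝ => transferK x (c + y * I) • W (c + y * I) := by
  have hφ := isContourMajorant_transferMajorant x (-c) hC
  have habove := (isMajorized_transferK_smul x (-c) hW hWle).integrableOn_comp hφ
    (w := fun y : ℝ => c + y * I) (by fun_prop) (abs_le_norm_add_mul_I' c) measurableSet_Ici
    fun y (hy : 0 ≤ y) => add_mul_I_mem_reProdIm.2 ⟨by simpa using hc, hy⟩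
  have hbelow := (isMajorized_transferKBelow_smul x (-c) hW hWle).integrableOn_comp hφ
    (w := fun y : ℝ => c + y * I) (by fun_prop) (abs_le_norm_add_mul_I' c) measurableSet_Iio
    fun y (hy : y < 0) => add_mul_I_mem_reProdIm.2 ⟨by simpa using hc, hy.le⟩
  rw [← integrableOn_univ, ← Iio_union_Ici (a := (0 : ℝ))]
  refine IntegrableOn.union (hbelow.congr_fun (fun y (hy : y < 0) => ?_) measurableSet_Iio) habove
  rw [transferK_eq_transferKBelow x (by simpa using hy)]

theorem integral_jumpG_smul (x : ℝ) (hξ : 0 ≤ ξ) (hC : 0 ≤ C)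
    (hW : ∀ z : ℂ, z.re ≤ 0 → DifferentiableAt ℂ W z)
    (hWle : ∀ z : ℂ, z.re ≤ 0 → z ≠ 0 → ‖W z‖ ≤ C * (1 + ‖z‖)⁻¹) :
    ∫ l in (0 : ℝ)..ξ, jumpG l x • W (-l) =
      I • ((∫ y : ℝ, transferK x (y * I) • W (y * I)) -
        ∫ y : ℝ, transferK x (-ξ + y * I) • W (-ξ + y * I)) := by
  have hφ := isContourMajorant_transferMajorant x ξ hC
  have habove := isMajorized_transferK_smul x ξ hW hWle
  have hbelow := isMajorized_transferKBelow_smul x ξ hW hWle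
  have hint : ∀ {f : ℂ → E} {T : Set ℝ}, 0 ∈ T →
      IsMajorized (transferMajorant x ξ C) f (Icc (-ξ) 0 ×ℂ T) →
      IntervalIntegrable (fun t : ℝ => f t) volume (-ξ) 0 := fun {f T} hT hf => by
    rw [intervalIntegrable_iff_integrableOn_Ioc_of_le (neg_nonpos.2 hξ)]
    exact hf.integrableOn_comp hφ (by fun_prop) (fun t => by simp) measurableSet_Ioc
      fun t ht => ⟨by simpa using Ioc_subset_Icc_self ht, by simpa using hT⟩
  have hshift := integral_vertical_sub_integral_vertical hφ (neg_nonpos.2 hξ) habove hbelow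
    fun z hz => by rw [transferK_eq_transferKBelow x hz]
  rw [← intervalIntegral.integral_sub (hint self_mem_Iic hbelow) (hint self_mem_Ici habove)]
    at hshift
  have hflip := intervalIntegral.integral_comp_neg (a := 0) (b := ξ) fun t : ℝ =>
    transferKBelow x t • W t - transferK x t • W t
  rw [neg_zero, ← hshift] at hflip
  push_cast at hflip
  simp only [zero_add] at hflip
  rw [← hflip]
  refine intervalIntegral.integral_congr_ae (.of_forall fun l hl => ?_)
  rw [uIoc_of_le hξ] at hl
  rw [jumpG_eq x hl.1, sub_smul]

end Contour

theorem matrixFunction_transferK_row {ι : Type*} [Fintype ι] [DecidableEq ι] {B : Matrix ι ι ℂ}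
    (hB : ∀ z ∈ spectrum ℂ B, 0 < z.re) (x : ℝ) (i : ι) :
    (matrixFunction (transferK x) B).row i =
      -((2 * Real.pi : ℝ)⁻¹ • ∫ y : ℝ, transferK x (y * I) • (resolvent B (y * I)).row i) := by
  obtain ⟨H, hH, hHeq⟩ := exists_sub_matrixFunction_eq_mul isOpen_slitPlane
    (differentiableOn_transferK x) fun z hz => .inl (hB z hz)
  have hU : {z : ℂ | 0 ≤ z.re} \ {0} ⊆ slitPlane := fun z hz => by
    rw [mem_slitPlane_iff_not_le_zero, Complex.le_def]
    exact fun h => hz.2 (Complex.ext (le_antisymm h.1 hz.1) h.2)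
  obtain ⟨hint, hintegral⟩ := integral_smul_resolvent hB hU hH hHeq fun z hz _ =>
    norm_transferK_le x (ξ := 0) (by simpa using hz)
  let rowL : Matrix ι ι ℂ →L[ℂ] ι → ℂ := (vecMulBilin ℂ ℂ (Pi.single i 1)).toContinuousLinearMap
  have hrowL : ∀ A : Matrix ι ι ℂ, rowL A = A.row i := single_one_vecMul i
  have hrow : ∫ y : ℝ, transferK x (y * I) • (resolvent B (y * I)).row i =
      -((2 * Real.pi : ℝ) • (matrixFunction (transferK x) B).row i) := by
    calc _ = ∫ y : ℝ, rowL (transferK x (y * I) • resolvent B (y * I)) := by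
          simp only [hrowL]; rfl
      _ = rowL (-((2 * Real.pi : ℝ) • matrixFunction (transferK x) B)) :=
          (rowL.integral_comp_comm hint).trans (congrArg rowL hintegral)
      _ = _ := hrowL _
  rw [hrow, smul_neg, neg_neg, smul_smul, inv_mul_cancel₀ Real.two_pi_pos.ne', one_smul]

namespace RungeKutta

variable {m : ℕ} {M : RungeKutta m} {h : ℝ} {z ζ : ℂ}

/-- The last row `r(hz)ⁿ q(hz)` of `E_n(hz)`, against which `K(·, x)` is integrated. -/
def stageWeight (M : RungeKutta m) (h : ℝ) (n : ℕ) (z : ℂ) : Fin (m + 1) → ℂ :=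
  M.r (h * z) ^ n • M.q (h * z)

theorem re_ofReal_mul_nonpos (hh : 0 < h) (hz : z.re ≤ 0) : ((h : ℂ) * z).re ≤ 0 := by
  rw [re_ofReal_mul]
  exact mul_nonpos_of_nonneg_of_nonpos hh.le hz

theorem norm_stageWeight_le (hA : M.IsAStable) (hh : 0 < h) (n : ℕ) (hz : z.re ≤ 0) :
    ‖M.stageWeight h n z‖ ≤ ‖M.q (h * z)‖ := by
  rw [stageWeight, norm_smul, norm_pow]
  exact mul_le_of_le_one_left (norm_nonneg _)
    (pow_le_one₀ (norm_nonneg _) (hA.stable _ (re_ofReal_mul_nonpos hh hz)))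

theorem differentiableAt_stageWeight (hA : M.IsAStable) (hh : 0 < h) (n : ℕ) (hz : z.re ≤ 0) :
    DifferentiableAt ℂ (M.stageWeight h n) z := by
  have hunit := hA.nonsingular _ (re_ofReal_mul_nonpos hh hz)
  have hmul : DifferentiableAt ℂ (fun z : ℂ => h * z) z := by fun_prop
  exact (((differentiableAt_r hunit).comp z hmul).pow n).smul
    ((differentiableAt_q hunit).comp z hmul)

theorem exists_norm_stageWeight_le (hA : M.IsAStable) (hS : M.IsStifflyAccurate) (hh : 0 < h) :
    ∃ C, 0 ≤ C ∧ ∀ (n : ℕ) (z : ℂ), z.re ≤ 0 → z ≠ 0 →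
      ‖M.stageWeight h n z‖ ≤ C * (1 + ‖z‖)⁻¹ := by
  obtain ⟨C, hC, hq⟩ := exists_norm_q_le hA hS
  refine ⟨C * (1 + h⁻¹), by positivity, fun n z hz hz0 => (norm_stageWeight_le hA hh n hz).trans ?_⟩
  refine (hq _ (re_ofReal_mul_nonpos hh hz) (mul_ne_zero (mod_cast hh.ne') hz0)).trans ?_
  rw [norm_mul, norm_real, Real.norm_of_nonneg hh.le, mul_assoc, ← div_eq_mul_inv (1 + h⁻¹)]
  gcongr
  rw [inv_le_iff_one_le_mul₀ (by positivity), div_mul_eq_mul_div, one_le_div (by positivity)]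
  calc 1 + ‖z‖ ≤ 1 + ‖z‖ + (h⁻¹ + h * ‖z‖) := le_add_of_nonneg_right (by positivity)
    _ = (1 + h⁻¹) * (1 + h * ‖z‖) := by field_simp; ring

theorem resolvent_inv_smul {ι : Type*} [Fintype ι] [DecidableEq ι] {B : Matrix ι ι ℂ} {a : ℂ}
    (ha : a ≠ 0) (hB : IsUnit (B - (a * z) • 1)) :
    resolvent (a⁻¹ • B) z = -(a • (B - (a * z) • 1)⁻¹) := by
  have hsmul : algebraMap ℂ _ z - a⁻¹ • B = -(a⁻¹ • (B - (a * z) • 1)) := by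
    rw [smul_sub, smul_smul, inv_mul_cancel_left₀ ha, neg_sub, Algebra.algebraMap_eq_smul_one]
  rw [resolvent, hsmul, ← nonsing_inv_eq_ringInverse]
  refine inv_eq_right_inv ?_
  rw [neg_mul_neg, smul_mul_smul_comm, inv_mul_cancel₀ ha, one_smul,
    mul_nonsing_inv _ ((isUnit_iff_isUnit_det _).1 hB)]

theorem re_pos_of_mem_spectrum_symbol (hA : M.IsAStable) (hS : M.IsStifflyAccurate) (hh : 0 < h)
    (hζ : ‖ζ‖ < 1) (hz : z ∈ spectrum ℂ ((h : ℂ)⁻¹ • M.symbol ζ)) : 0 < z.re := by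
  by_contra! hre
  have hh0 : (h : ℂ) ≠ 0 := mod_cast hh.ne'
  refine spectrum.mem_iff.1
    ((spectrum.smul_mem_smul_iff (r := Units.mk0 (h : ℂ) hh0)).2 hz) (IsUnit.sub_iff.1 ?_)
  rw [Units.smul_def, Units.val_mk0, Units.smul_def, Units.val_mk0, smul_inv_smul₀ hh0,
    Algebra.algebraMap_eq_smul_one]
  exact isUnit_symbol_sub hA hS hζ (re_ofReal_mul_nonpos hh hre)

theorem matrixFunction_symbol_last (hA : M.IsAStable) (hS : M.IsStifflyAccurate) (hh : 0 < h)
    (hζ : ‖ζ‖ < 1) (x : ℝ) :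
    (matrixFunction (transferK x) ((h : ℂ)⁻¹ • M.symbol ζ)).row (Fin.last m) =
      ((h : ℂ) / (2 * Real.pi)) • ∫ y : ℝ, transferK x (y * I) •
        (M.symbol ζ - ((h : ℂ) * (y * I)) • 1)⁻¹.row (Fin.last m) := by
  rw [matrixFunction_transferK_row fun z => re_pos_of_mem_spectrum_symbol hA hS hh hζ]
  have hres : ∀ y : ℝ, (resolvent ((h : ℂ)⁻¹ • M.symbol ζ) (y * I)).row (Fin.last m) =
      -(h : ℂ) • (M.symbol ζ - ((h : ℂ) * (y * I)) • 1)⁻¹.row (Fin.last m) := fun y => by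
    rw [resolvent_inv_smul (mod_cast hh.ne')
      (isUnit_symbol_sub hA hS hζ (re_ofReal_mul_nonpos hh (by simp))), neg_smul]
    rfl
  simp only [hres, smul_comm _ (-(h : ℂ))]
  rw [integral_smul, ← coe_smul, smul_smul, ← neg_smul]
  congr 1
  push_cast
  ring

theorem omega_eq (hA : M.IsAStable) (hS : M.IsStifflyAccurate) (hh : 0 < h) (x : ℝ) (n : ℕ) :
    M.omega h x n =
      ((h : ℂ) / (2 * Real.pi)) • ∫ y : ℝ, transferK x (y * I) • M.stageWeight h n (y * I) := by
  obtain ⟨C, hC, hle⟩ := exists_norm_stageWeight_le hA hS hh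
  have hint : ∀ n, Integrable fun y : ℝ => transferK x (y * I) • M.stageWeight h n (y * I) :=
    fun n => by
      simpa using integrable_transferK_smul x hC
        (fun z hz => differentiableAt_stageWeight hA hh n hz) (hle n) le_rfl
  refine powerCoeff_row_of_hasSum (c := fun n => ((h : ℂ) / (2 * Real.pi)) •
    ∫ y : ℝ, transferK x (y * I) • M.stageWeight h n (y * I)) (fun ζ hζ => ?_) n
  rw [matrixFunction_symbol_last hA hS hh hζ]
  simp only [smul_comm _ ((h : ℂ) / (2 * Real.pi)), ← integral_smul (_ ^ _ : ℂ)]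
  refine HasSum.const_smul _ (hasSum_integral_of_dominated_convergence
    (fun n y => ‖ζ‖ ^ n * ‖transferK x (y * I) • M.q (h * (y * I))‖)
    (fun n => (hint n).aestronglyMeasurable.const_smul (ζ ^ n)) (fun n => .of_forall fun y => ?_)
    (.of_forall fun y => (summable_geometric_of_lt_one (norm_nonneg _) hζ).mul_right _) ?_
    (.of_forall fun y => ?_))
  · rw [norm_smul, norm_pow, norm_smul, norm_smul]
    gcongr
    exact norm_stageWeight_le hA hh n (by simp)
  · simp only [tsum_mul_right]
    simpa [stageWeight] using (hint 0).norm.const_mul (∑' n, ‖ζ‖ ^ n)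
  · have hsum := hasSum_symbol_sub_inv_last hA hS hζ (z := h * (y * I))
      (re_ofReal_mul_nonpos hh (by simp))
    simp only [smul_comm (ζ ^ _) (transferK x (y * I))]
    exact hsum.const_smul _

theorem omega_sub_truncatedIntegral (hA : M.IsAStable) (hS : M.IsStifflyAccurate) (hh : 0 < h)
    (x : ℝ) {ξ : ℝ} (hξ : 0 ≤ ξ) (n : ℕ) :
    M.omega h x n - M.truncatedIntegral h x ξ n = ((h : ℂ) / (2 * Real.pi)) •
      ∫ y : ℝ, transferK x (-ξ + y * I) • M.stageWeight h n (-ξ + y * I) := by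
  obtain ⟨C, hC, hle⟩ := exists_norm_stageWeight_le hA hS hh
  have hjump : ∫ l in (0 : ℝ)..ξ, jumpG l x • M.e n (-((h * l : ℝ) : ℂ)) =
      ∫ l in (0 : ℝ)..ξ, jumpG l x • M.stageWeight h n (-l) := by
    refine intervalIntegral.integral_congr fun l hl => ?_
    rw [uIcc_of_le hξ] at hl
    simp only [stageWeight, mul_neg, ← ofReal_mul]
    rw [e_eq hA hS n (by simpa using mul_nonneg hh.le hl.1)]
  rw [truncatedIntegral, hjump, omega_eq hA hS hh, integral_jumpG_smul x hξ hC
    (fun z hz => differentiableAt_stageWeight hA hh n hz) (hle n), smul_smul,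
    ← div_div _ _ I, div_mul_cancel₀ _ I_ne_zero, smul_sub, sub_sub_cancel]

end RungeKutta

theorem exists_dual_apply_eq_seminorm {𝕜 E : Type*} [RCLike 𝕜] [AddCommGroup E] [Module 𝕜 E]
    (p : Seminorm 𝕜 E) (v : E) :
    ∃ f : Module.Dual 𝕜 E, (∀ x, ‖f x‖ ≤ p x) ∧ f v = p v := by
  let := p.toAddGroupSeminorm.toSeminormedAddCommGroup
  let : NormedSpace 𝕜 E := ⟨fun a x => (map_smul_eq_mul p a x).le⟩
  obtain ⟨f, hf, hfv⟩ := exists_dual_vector'' 𝕜 v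
  exact ⟨f, fun x => f.le_of_opNorm_le hf x |>.trans_eq (one_mul _), hfv⟩

theorem seminorm_integral_le_of_le {α E : Type*} [MeasurableSpace α] {μ : Measure α}
    [NormedAddCommGroup E] [NormedSpace ℂ E] [FiniteDimensional ℂ E] (p : Seminorm ℂ E)
    {f : α → E} {g : α → ℝ} (hf : Integrable f μ) (hg : Integrable g μ) (hfg : ∀ a, p (f a) ≤ g a) :
    p (∫ a, f a ∂μ) ≤ ∫ a, g a ∂μ := by
  have := FiniteDimensional.complete ℂ E
  obtain ⟨φ, hφ, hφp⟩ := exists_dual_apply_eq_seminorm p (∫ a, f a ∂μ)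
  calc p (∫ a, f a ∂μ) = ‖φ (∫ a, f a ∂μ)‖ := by
        rw [hφp, RCLike.norm_ofReal, abs_of_nonneg (apply_nonneg p _)]
    _ = ‖∫ a, φ (f a) ∂μ‖ := by
        rw [← LinearMap.coe_toContinuousLinearMap' φ, ← ContinuousLinearMap.integral_comp_comm _ hf]
    _ ≤ ∫ a, g a ∂μ :=
        norm_integral_le_of_norm_le hg (.of_forall fun a => (hφ _).trans (hfg a))

section Gamma

variable {s t : ℝ}

theorem rpow_mul_exp_neg_one_add_sq_mul (s t y : ℝ) :
    t ^ (s - 1) * Real.exp (-((1 + y ^ 2) * t)) =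
      t ^ (s - 1) * Real.exp (-t) * Real.exp (-t * y ^ 2) := by
  rw [mul_assoc, ← Real.exp_add]
  ring_nf

theorem integral_rpow_mul_exp_neg_one_add_sq_mul (s : ℝ) (ht : 0 < t) :
    ∫ y : ℝ, t ^ (s - 1) * Real.exp (-((1 + y ^ 2) * t)) =
      √Real.pi * (Real.exp (-t) * t ^ (s - 1 / 2 - 1)) := by
  have hrpow : t ^ (s - 1 / 2 - 1) = t ^ (s - 1) / √t := by
    rw [Real.sqrt_eq_rpow, ← Real.rpow_sub ht]
    ring_nf
  simp only [rpow_mul_exp_neg_one_add_sq_mul]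
  rw [integral_const_mul, integral_gaussian, Real.sqrt_div Real.pi_nonneg, hrpow]
  ring

theorem integrable_prod_rpow_mul_exp_neg_one_add_sq_mul (hs : 1 / 2 < s) :
    Integrable (fun p : ℝ × ℝ => p.2 ^ (s - 1) * Real.exp (-((1 + p.1 ^ 2) * p.2)))
      (volume.prod (volume.restrict (Ioi 0))) := by
  rw [integrable_prod_iff' (by fun_prop)]
  constructor
  · filter_upwards [ae_restrict_mem measurableSet_Ioi] with t (ht : 0 < t)
    simp only [rpow_mul_exp_neg_one_add_sq_mul]
    exact (integrable_exp_neg_mul_sq ht).const_mul _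
  · refine IntegrableOn.congr_fun ((Real.GammaIntegral_convergent (sub_pos.2 hs)).const_mul
      √Real.pi) (fun t (ht : 0 < t) => ?_) measurableSet_Ioi
    rw [← integral_rpow_mul_exp_neg_one_add_sq_mul s ht]
    exact integral_congr_ae (.of_forall fun y => (Real.norm_of_nonneg (by positivity)).symm)

theorem integral_one_add_sq_rpow_neg (hs : 1 / 2 < s) :
    ∫ y : ℝ, (1 + y ^ 2) ^ (-s) = √Real.pi * Real.Gamma (s - 1 / 2) / Real.Gamma s := by
  have hs0 : 0 < s := one_half_pos.trans hs
  have hinner : ∀ y : ℝ, ∫ t in Ioi (0 : ℝ), t ^ (s - 1) * Real.exp (-((1 + y ^ 2) * t)) =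
      (1 + y ^ 2) ^ (-s) * Real.Gamma s := fun y => by
    have hy : 0 < 1 + y ^ 2 := by positivity
    rw [Real.integral_rpow_mul_exp_neg_mul_Ioi hs0 hy, one_div, Real.inv_rpow hy.le,
      Real.rpow_neg hy.le]
  rw [eq_div_iff (Real.Gamma_pos_of_pos hs0).ne', ← integral_mul_const]
  simp only [← hinner]
  rw [integral_integral_swap (integrable_prod_rpow_mul_exp_neg_one_add_sq_mul hs),
    setIntegral_congr_fun measurableSet_Ioi fun t ht =>
      integral_rpow_mul_exp_neg_one_add_sq_mul s ht, integral_const_mul,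
    Real.Gamma_eq_integral (sub_pos.2 hs)]

theorem Gamma_one_div_four : Real.Gamma (1 / 4) = Real.pi * √2 / Real.Gamma (3 / 4) := by
  have hrefl := Real.Gamma_mul_Gamma_one_sub (1 / 4)
  rw [show (1 : ℝ) - 1 / 4 = 3 / 4 by norm_num, mul_one_div, Real.sin_pi_div_four] at hrefl
  rw [eq_div_iff (Real.Gamma_pos_of_pos (by norm_num)).ne', hrefl,
    div_eq_iff (by positivity)]
  linear_combination (-Real.pi / 2) * Real.mul_self_sqrt zero_le_two

variable {ξ : ℝ}

theorem sq_add_sq_rpow (hξ : 0 < ξ) (y : ℝ) :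
    (ξ ^ 2 + y ^ 2) ^ (-(3 / 4) : ℝ) =
      (√ξ)⁻¹ * ξ⁻¹ * (1 + (y / ξ) ^ 2) ^ (-(3 / 4) : ℝ) := by
  have hsum : ξ ^ 2 + y ^ 2 = ξ ^ 2 * (1 + (y / ξ) ^ 2) := by field_simp
  rw [hsum, Real.mul_rpow (by positivity) (by positivity), ← Real.rpow_natCast ξ 2,
    ← Real.rpow_mul hξ.le, Real.sqrt_eq_rpow, ← Real.rpow_neg hξ.le, ← Real.rpow_neg_one ξ,
    ← Real.rpow_add hξ]
  norm_num

theorem integrable_sq_add_sq_rpow (hξ : 0 < ξ) :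
    Integrable fun y : ℝ => (ξ ^ 2 + y ^ 2) ^ (-(3 / 4) : ℝ) := by
  have hone : Integrable fun y : ℝ => (1 + y ^ 2) ^ (-(3 / 4) : ℝ) :=
    (integrable_rpow_neg_one_add_norm_sq (E := ℝ) (μ := volume) (r := 3 / 2) (by norm_num)).congr
      (.of_forall fun y => by norm_num)
  simp only [sq_add_sq_rpow hξ]
  exact (hone.comp_div hξ.ne').const_mul _

theorem integral_sq_add_sq_rpow (hξ : 0 < ξ) :
    ∫ y : ℝ, (ξ ^ 2 + y ^ 2) ^ (-(3 / 4) : ℝ) =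
      Real.pi * √(2 * Real.pi) / (√ξ * Real.Gamma (3 / 4) ^ 2) := by
  simp only [sq_add_sq_rpow hξ]
  rw [integral_const_mul, Measure.integral_comp_div (fun y : ℝ => (1 + y ^ 2) ^ (-(3 / 4) : ℝ)),
    integral_one_add_sq_rpow_neg (by norm_num), abs_of_pos hξ, smul_eq_mul,
    show (3 / 4 : ℝ) - 1 / 2 = 1 / 4 by norm_num, Gamma_one_div_four,
    Real.sqrt_mul zero_le_two]
  field_simp

end Gamma

theorem inv_sqrt_norm_mul_inv_norm {ξ : ℝ} (hξ : 0 < ξ) (y : ℝ) :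
    (√‖-(ξ : ℂ) + y * I‖)⁻¹ * ‖-(ξ : ℂ) + y * I‖⁻¹ = (ξ ^ 2 + y ^ 2) ^ (-(3 / 4) : ℝ) := by
  have hsq : ξ ^ 2 + y ^ 2 = ‖-(ξ : ℂ) + y * I‖ ^ 2 := by
    rw [← ofReal_neg, Complex.sq_norm, normSq_add_mul_I, neg_sq]
  have hpos : 0 < ‖-(ξ : ℂ) + y * I‖ := by
    refine norm_pos_iff.2 fun h => hξ.ne' ?_
    simpa using congrArg re h
  rw [hsq, ← Real.rpow_natCast, ← Real.rpow_mul hpos.le, Real.sqrt_eq_rpow,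
    ← Real.rpow_neg hpos.le, ← Real.rpow_neg_one, ← Real.rpow_add hpos]
  norm_num

namespace RungeKutta

variable {m : ℕ} {M : RungeKutta m} {N : Seminorm ℂ (Fin (m + 1) → ℂ)} {h ξ C : ℝ}

theorem IsDecayConstant.seminorm_stageWeight_le (hC : M.IsDecayConstant N C) (hA : M.IsAStable)
    (hh : 0 < h) (hξ : 0 < ξ) (n : ℕ) {z : ℂ} (hz : z.re = -ξ) :
    N (M.stageWeight h n z) ≤
      Real.exp (-(h * ξ * M.gamma (h * ξ))) ^ n * (C * (h⁻¹ * ‖z‖⁻¹)) := by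
  have hre : ((h : ℂ) * z).re = -(h * ξ) := by rw [re_ofReal_mul, hz, mul_neg]
  have hz0 : z ≠ 0 := by
    rintro rfl
    exact (neg_neg_of_pos hξ).ne hz.symm
  have hq := (le_max_right _ _).trans (hC.2 (h * z)
    (re_ofReal_mul_nonpos hh (hz.trans_le (neg_nonpos.2 hξ.le)))
    (mul_ne_zero (mod_cast hh.ne') hz0))
  rw [norm_mul, norm_real, Real.norm_of_nonneg hh.le, mul_inv] at hq
  rw [stageWeight, map_smul_eq_mul, norm_pow]
  gcongr
  exact norm_r_le_exp hA (mul_pos hh hξ) hre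

theorem IsDecayConstant.seminorm_transferK_smul_stageWeight_le (hC : M.IsDecayConstant N C)
    (hA : M.IsAStable) (hh : 0 < h) (hξ : 0 < ξ) (x : ℝ) (n : ℕ) (y : ℝ) :
    N (transferK x (-ξ + y * I) • M.stageWeight h n (-ξ + y * I)) ≤
      Real.exp (|x| * √(ξ / 2)) / 2 * Real.exp (-(h * ξ * M.gamma (h * ξ))) ^ n * (C * h⁻¹) *
        (ξ ^ 2 + y ^ 2) ^ (-(3 / 4) : ℝ) := by
  have hre : (-(ξ : ℂ) + y * I).re = -ξ := by simp
  rw [map_smul_eq_mul, ← inv_sqrt_norm_mul_inv_norm hξ]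
  calc _ ≤ (Real.exp (|x| * √(ξ / 2)) / 2 * (√‖-(ξ : ℂ) + y * I‖)⁻¹) *
        (Real.exp (-(h * ξ * M.gamma (h * ξ))) ^ n * (C * (h⁻¹ * ‖-(ξ : ℂ) + y * I‖⁻¹))) :=
        mul_le_mul (norm_transferK_le x hre.ge) (hC.seminorm_stageWeight_le hA hh hξ n hre)
          (apply_nonneg N _) (by positivity)
    _ = _ := by ring

theorem IsDecayConstant.seminorm_omega_sub_truncatedIntegral_le (hC : M.IsDecayConstant N C)
    (hA : M.IsAStable) (hS : M.IsStifflyAccurate) (hh : 0 < h) (hξ : 0 < ξ) (x : ℝ) (n : ℕ) :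
    N (M.omega h x n - M.truncatedIntegral h x ξ n) ≤
      C * √(2 * Real.pi) / (4 * √ξ * Real.Gamma (3 / 4) ^ 2) *
        Real.exp (|x| * √(ξ / 2) - n * (h * ξ * M.gamma (h * ξ))) := by
  obtain ⟨B, hB, hle⟩ := exists_norm_stageWeight_le hA hS hh
  have hint : Integrable fun y : ℝ =>
      transferK x (-ξ + y * I) • M.stageWeight h n (-ξ + y * I) := by
    simpa using integrable_transferK_smul x hB
      (fun z hz => differentiableAt_stageWeight hA hh n hz) (hle n) (neg_nonpos.2 hξ.le)
  have hG : 0 < Real.Gamma (3 / 4) := Real.Gamma_pos_of_pos (by norm_num)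
  have hconst : ‖(h : ℂ) / (2 * Real.pi)‖ = h / (2 * Real.pi) := by
    rw [← ofReal_ofNat, ← ofReal_mul, ← ofReal_div, norm_real, Real.norm_of_nonneg (by positivity)]
  rw [omega_sub_truncatedIntegral hA hS hh x hξ.le, map_smul_eq_mul, hconst]
  refine (mul_le_mul_of_nonneg_left (seminorm_integral_le_of_le N hint
    ((integrable_sq_add_sq_rpow hξ).const_mul _)
    (hC.seminorm_transferK_smul_stageWeight_le hA hh hξ x n)) (by positivity)).trans_eq ?_
  rw [integral_const_mul, integral_sq_add_sq_rpow hξ, sub_eq_add_neg, Real.exp_add,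
    ← Real.exp_nat_mul, mul_neg]
  field_simp
  ring

end RungeKutta

theorem mul_exp_sub_le_of_log_le {K D ε a t : ℝ} (hK : 0 < K) (hD : 0 < D) (hε : 0 < ε)
    (ht : 1 / D * (a + Real.log (K / ε)) ≤ t) : K * Real.exp (a - t * D) ≤ ε := by
  rw [one_div, inv_mul_le_iff₀ hD] at ht
  calc K * Real.exp (a - t * D) ≤ K * Real.exp (-Real.log (K / ε)) := by
        gcongr
        linarith
    _ = ε := by
        rw [Real.exp_neg, Real.exp_log (by positivity), inv_div, mul_div_cancel₀ _ hK.ne']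

end RKCQ

end

theorem corollary4p2_general {m : ℕ} {M : RKCQ.RungeKutta m} (hA : M.IsAStable)
    (hS : M.IsStifflyAccurate) (N : Seminorm ℂ (Fin (m + 1) → ℂ)) {h : ℝ} (hh : 0 < h) (x : ℝ)
    {ξ : ℝ} (hξ : 0 < ξ) :
    0 < M.gamma (h * ξ) ∧
    (∃ C : ℝ, M.IsDecayConstant N C) ∧
    ∀ C : ℝ, M.IsDecayConstant N C → ∀ ε : ℝ, 0 < ε → ∀ n : ℕ,
      (n : ℝ) ≥ 1 / (h * ξ * M.gamma (h * ξ)) *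
        (|x| * Real.sqrt (ξ / 2) +
          Real.log (C * Real.sqrt (2 * Real.pi) /
            (4 * Real.sqrt ξ * Real.Gamma (3 / 4) ^ 2 * ε))) →
      N (M.omega h x n - M.truncatedIntegral h x ξ n) ≤ ε := by
  have hγ := RKCQ.RungeKutta.gamma_pos hA hS (mul_pos hh hξ)
  refine ⟨hγ, RKCQ.RungeKutta.exists_isDecayConstant hA hS N, fun C hC ε hε n hn => ?_⟩
  have hG : 0 < Real.Gamma (3 / 4) := Real.Gamma_pos_of_pos (by norm_num)
  have hC0 : 0 < C := hC.1
  rw [← div_div (C * _)] at hn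
  exact (hC.seminorm_omega_sub_truncatedIntegral_le hA hS hh hξ x n).trans
    (RKCQ.mul_exp_sub_le_of_log_le (by positivity) (by positivity) hε hn)

theorem corollary4p2 {m : ℕ} (M : RKCQ.RungeKutta m) (hM : M.Admissible)
    (N : Seminorm ℂ (Fin (m + 1) → ℂ)) (h : ℝ) (hh : 0 < h) (x : ℝ) (ξ : ℝ) (hξ : 1 < ξ) :
    0 < M.gamma (h * ξ) ∧
    (∃ C : ℝ, M.IsDecayConstant N C) ∧
    ∀ C : ℝ, M.IsDecayConstant N C → ∀ ε : ℝ, 0 < ε → ∀ n : ℕ,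
      (n : ℝ) ≥ 1 / (h * ξ * M.gamma (h * ξ)) *
        (|x| * Real.sqrt (ξ / 2) +
          Real.log (C * Real.sqrt (2 * Real.pi) /
            (4 * Real.sqrt ξ * Real.Gamma (3 / 4) ^ 2 * ε))) →
      N (M.omega h x n - M.truncatedIntegral h x ξ n) ≤ ε :=
  corollary4p2_general hM.isAStable hM.isStifflyAccurate N hh x (zero_lt_one.trans hξ)
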